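/- Let $\mathbf{k}$ be a field. All gradings are by $\mathbb{Z}$ and cohomological. Every filtration $F$ of a graded vector space $A=\bigoplus_n A^n$ consists of subspaces $F^{p+1}A^n\subseteq F^pA^n\subseteq A^n$ ($p,n\in\mathbb{Z}$), and is exhaustive ($A^n=\bigcup_p F^pA^n$) and bounded below (for every $n$ there is a $p$ with $F^pA^n=0$). A *filtered dg-algebra* $(A,d,\mu,F)$ is a filtered graded vector space with a differential $d$ of degree $1$ satisfying $d(F^pA^n)\subseteq F^pA^{n+1}$, and an associative (not necessarily unital) product $\mu$ satisfying $\mu(F^pA^n\otimes F^{p'}A^{n'})\subseteq F^{p+p'}A^{n+n'}$ and $d(xy)=d(x)\,y+(-1)^{n}x\,d(y)$ for $x\in A^n$. The first page of its spectral sequence is $$E_1^{p,q}(A)=\frac{\{x\in F^pA^{p+q} : dx\in F^{p+1}A^{p+q+1}\}}{F^{p+1}A^{p+q}+d(F^pA^{p+q-1})}\cong H^{p+q}(F^pA/F^{p+1}A).$$ A *filtered $A_\infty$-algebra* is a filtered graded vector space $M$ with linear maps $\nu_s:M^{\otimes s}\to M$ of degree $2-s$ ($s\ge1$, $d:=\nu_1$)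 such that for all $n\ge1$ $$\sum_{r+s+t=n,\ s\ge1}(-1)^{r+st}\,\nu_{r+1+t}\,(1^{\otimes r}\otimes\nu_s\otimes1^{\otimes t})=0$$ (with the Koszul sign rule) and $$\nu_s(F^{p_1}M^{n_1}\otimes\cdots\otimes F^{p_s}M^{n_s})\subseteq F^{p_1+\cdots+p_s}M^{n_1+\cdots+n_s+2-s}.$$ A filtered dg-algebra is a filtered $A_\infty$-algebra with $\nu_1=d$, $\nu_2=\mu$ and $\nu_s=0$ for $s\ge3$. A *filtered $A_\infty$-morphism* $f:M\to N$ consists of linear maps $f_s:M^{\otimes s}\to N$ of degree $1-s$ ($s\ge1$) such that for all $n\ge1$ $$\sum_{r+s+t=n,\ s\ge1}(-1)^{r+st}f_{r+1+t}(1^{\otimes r}\otimes\nu_s\otimes1^{\otimes t})=\sum_{i_1+\cdots+i_r=n,\ i_l\ge1}(-1)^{\sum_{l}(r-l)(i_l-1)}\nu_r(f_{i_1}\otimes\cdots\otimes f_{i_r})$$ and $$f_s(F^{p_1}M^{n_1}\otimes\cdots\otimes F^{p_s}M^{n_s})\subseteq F^{p_1+\cdots+p_s}N^{n_1+\cdots+n_s+1-s}.$$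 It is a *filtered quasi-isomorphism* if $f_1$ induces isomorphisms $H^n(F^pM)\to H^n(F^pN)$ for all $p,n$. **Theorem.** Every filtered dg-algebra $A$ has a filtered minimal $A_\infty$-model. That is, there are a filtered $A_\infty$-algebra $M$ and a bigrading $M=\bigoplus_{p,q}M^{p,q}$ with $M^{p,q}\subseteq M^{p+q}$ such that for all $p,n$ $$F^pM^n=\bigoplus_{q\ge p}M^{q,n-q}\quad\text{and}\quad d(F^pM^n)\subseteq F^{p+1}M^{n+1},$$ together with a filtered $A_\infty$-morphism $M\to A$ which is a filtered quasi-isomorphism. Moreover $M^{p,q}\cong E_1^{p,q}(A)$ as $\mathbf{k}$-vector spaces for all $p,q$. -/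

import Mathlib

universe u v w

open Finset

/-- A grading of a `k`-vector space by the integers: `A = ⨁ₙ Aⁿ`, with `Aⁿ = gr n`. -/
structure GradedSpace (k : Type u) (A : Type v) [Field k] [AddCommGroup A] [Module k A] where
  gr : ℤ → Submodule k A
  isInternal : DirectSum.IsInternal gr

/-- A graded vector space with a decreasing filtration `Fᵖ Aⁿ = F p n`, which is exhaustive
and bounded below (for each degree `n` there is a `p` with `Fᵖ Aⁿ = 0`). -/
structure FilteredSpace (k : Type u) (A : Type v) [Field k] [AddCommGroup A] [Module k A]
    extends GradedSpace k A where
  F : ℤ → ℤ → Submodule k A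
  F_le : ∀ p n, F p n ≤ gr n
  F_anti : ∀ p n, F (p + 1) n ≤ F p n
  F_exhaustive : ∀ n, ∀ x ∈ gr n, ∃ p, x ∈ F p n
  F_bddBelow : ∀ n, ∃ p, F p n = ⊥

/-- A filtered cochain complex. -/
structure FilteredComplex (k : Type u) (A : Type v) [Field k] [AddCommGroup A] [Module k A]
    extends FilteredSpace k A where
  d : A →ₗ[k] A
  d_mem : ∀ n, ∀ x ∈ gr n, d x ∈ gr (n + 1)
  d_d : ∀ x, d (d x) = 0
  d_F : ∀ p n, ∀ x ∈ F p n, d x ∈ F p (n + 1)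

/-- A filtered dg-algebra: a filtered complex with an associative product of degree `0`,
compatible with the filtration, for which the differential is a graded derivation.
No unit is required. -/
structure FilteredDGAlgebra (k : Type u) (A : Type v) [Field k] [AddCommGroup A] [Module k A]
    extends FilteredComplex k A where
  mul : A →ₗ[k] A →ₗ[k] A
  mul_mem : ∀ n n', ∀ x ∈ gr n, ∀ y ∈ gr n', mul x y ∈ gr (n + n')
  mul_assoc : ∀ x y z, mul (mul x y) z = mul x (mul y z)
  leibniz : ∀ n, ∀ x ∈ gr n, ∀ y, d (mul x y) = mul (d x) y + n.negOnePow • mul x (d y)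
  mul_F : ∀ p n p' n', ∀ x ∈ F p n, ∀ y ∈ F p' n', mul x y ∈ F (p + p') (n + n')

namespace FilteredComplex

section

variable {k : Type u} {A : Type v} [Field k] [AddCommGroup A] [Module k A]
  (C : FilteredComplex k A)

/-- The cocycles of degree `n` of the complex `Fᵖ A`. -/
def cocycles (p n : ℤ) : Submodule k A := C.F p n ⊓ LinearMap.ker C.d

/-- The coboundaries of degree `n` of the complex `Fᵖ A`. -/
def coboundaries (p n : ℤ) : Submodule k A := (C.F p (n - 1)).map C.d

/-- The cohomology `Hⁿ(Fᵖ A)`. -/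
abbrev H (p n : ℤ) : Type v :=
  C.cocycles p n ⧸ (C.coboundaries p n).submoduleOf (C.cocycles p n)

/-- `Z₁^{p,q} = {x ∈ Fᵖ A^{p+q} | d x ∈ Fᵖ⁺¹ A^{p+q+1}}`. -/
def Z1 (p q : ℤ) : Submodule k A :=
  C.F p (p + q) ⊓ (C.F (p + 1) (p + q + 1)).comap C.d

/-- `B₁^{p,q} = Fᵖ⁺¹ A^{p+q} + d (Fᵖ A^{p+q-1})`. -/
def B1 (p q : ℤ) : Submodule k A :=
  C.F (p + 1) (p + q) ⊔ (C.F p (p + q - 1)).map C.d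

/-- The first page `E₁^{p,q} = Z₁^{p,q} / B₁^{p,q} = H^{p+q}(Fᵖ A / Fᵖ⁺¹ A)` of the spectral
sequence of the filtration. -/
abbrev E1 (p q : ℤ) : Type v := C.Z1 p q ⧸ (C.B1 p q).submoduleOf (C.Z1 p q)

end

section

variable {k : Type u} {A : Type v} {B : Type w} [Field k] [AddCommGroup A] [Module k A]
  [AddCommGroup B] [Module k B]

/-- A morphism of filtered complexes. -/
structure Hom (C : FilteredComplex k A) (D : FilteredComplex k B) where
  f : A →ₗ[k] B
  f_mem : ∀ n, ∀ x ∈ C.gr n, f x ∈ D.gr n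
  f_F : ∀ p n, ∀ x ∈ C.F p n, f x ∈ D.F p n
  f_d : ∀ x, f (C.d x) = D.d (f x)

variable {C : FilteredComplex k A} {D : FilteredComplex k B}

theorem Hom.map_cocycles (φ : Hom C D) (p n : ℤ) :
    ∀ x ∈ C.cocycles p n, φ.f x ∈ D.cocycles p n := by
  rintro x ⟨hx, hdx⟩
  refine ⟨φ.f_F p n x hx, ?_⟩
  change D.d (φ.f x) = 0
  rw [← φ.f_d, LinearMap.mem_ker.mp hdx, map_zero]

/-- The map `Fᵖ f` on cocycles. -/
def Hom.cocyclesMap (φ : Hom C D) (p n : ℤ) : C.cocycles p n →ₗ[k] D.cocycles p n :=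
  φ.f.restrict (φ.map_cocycles p n)

/-- The map `Hⁿ(Fᵖ f) : Hⁿ(Fᵖ A) → Hⁿ(Fᵖ B)` induced by `f`. -/
def Hom.mapH (φ : Hom C D) (p n : ℤ) : C.H p n →ₗ[k] D.H p n :=
  Submodule.mapQ _ _ (φ.cocyclesMap p n) (by
    rintro ⟨x, hx⟩ ⟨y, hy, hyx⟩
    exact ⟨φ.f y, φ.f_F _ _ y hy, by
      rw [← φ.f_d, hyx]; rfl⟩)

/-- `f` is a filtered quasi-isomorphism if each `Fᵖ f` is a quasi-isomorphism. -/
def Hom.IsFilteredQuasiIso (φ : Hom C D) : Prop :=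
  ∀ p n, Function.Bijective (φ.mapH p n)

end

end FilteredComplex

/-- The sequence `(a₀, …, a_{r-1}, y, a_{r+s}, a_{r+s+1}, …)`: the entries `a_r, …, a_{r+s-1}`
are replaced by the single entry `y`. -/
def replaceBlock {A : Type v} (a : ℕ → A) (r s : ℕ) (y : A) : ℕ → A :=
  fun i => if i < r then a i else if i = r then y else a (i - 1 + s)

/-- The value of `(-1)^{r+st} f_{r+1+t} (1^{⊗r} ⊗ m_s ⊗ 1^{⊗t})` on the tensor
`a₀ ⊗ ⋯ ⊗ a_{r+s+t-1}` of homogeneous elements of degrees `deg 0, deg 1, …`. By the Koszul sign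
rule, moving `m_s`, of degree `2 - s`, past `a₀, …, a_{r-1}` gives the sign
`(-1)^{s (deg 0 + ⋯ + deg (r-1))}`. -/
def innerTerm {k : Type u} {A : Type v} {B : Type w} [Field k] [AddCommGroup A] [Module k A]
    [AddCommGroup B] [Module k B]
    (m : (s : ℕ) → MultilinearMap k (fun _ : Fin s => A) A)
    (f : (s : ℕ) → MultilinearMap k (fun _ : Fin s => A) B)
    (a : ℕ → A) (deg : ℕ → ℤ) (r s t : ℕ) : B :=
  ((r : ℤ) + s * t + s * ∑ i ∈ range r, deg i).negOnePow •
    f (r + 1 + t) (fun i => replaceBlock a r s (m s (fun j => a (r + j))) i)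

/-- The value of `∑_{r+s+t=n} (-1)^{r+st} f_{r+1+t} (1^{⊗r} ⊗ m_s ⊗ 1^{⊗t})` on the tensor
`a₀ ⊗ ⋯ ⊗ a_{n-1}` of homogeneous elements of degrees `deg 0, …, deg (n-1)`. -/
def innerSum {k : Type u} {A : Type v} {B : Type w} [Field k] [AddCommGroup A] [Module k A]
    [AddCommGroup B] [Module k B]
    (m : (s : ℕ) → MultilinearMap k (fun _ : Fin s => A) A)
    (f : (s : ℕ) → MultilinearMap k (fun _ : Fin s => A) B)
    (n : ℕ) (a : ℕ → A) (deg : ℕ → ℤ) : B :=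
  ∑ x ∈ antidiagonal n, ∑ y ∈ antidiagonal x.2, innerTerm m f a deg x.1 y.1 y.2

/-- The value of
`∑_{i₁+⋯+i_r=n} (-1)^{(r-1)(i₁-1)+(r-2)(i₂-1)+⋯+(i_{r-1}-1)} m_r (f_{i₁} ⊗ ⋯ ⊗ f_{i_r})`
on the tensor `a₀ ⊗ ⋯ ⊗ a_{n-1}` of homogeneous elements of degrees `deg 0, …, deg (n-1)`.
The Koszul sign rule contributes `(-1)^{(1-i_l) e_l}` for each `l`, where `1 - i_l` is the degree
of `f_{i_l}` and `e_l` is the sum of the degrees of the entries before the `l`-th block.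
(The index `l` runs from `0` here, so the factor `r - l` becomes `r - 1 - l`.) -/
def outerSum {k : Type u} {A : Type v} {B : Type w} [Field k] [AddCommGroup A] [Module k A]
    [AddCommGroup B] [Module k B]
    (m : (s : ℕ) → MultilinearMap k (fun _ : Fin s => B) B)
    (f : (s : ℕ) → MultilinearMap k (fun _ : Fin s => A) B)
    (n : ℕ) (a : ℕ → A) (deg : ℕ → ℤ) : B :=
  ∑ c : Composition n,
    (∑ l : Fin c.length, (((c.length : ℤ) - 1 - (l : ℕ)) * ((c.blocksFun l : ℤ) - 1) +
        (1 - (c.blocksFun l : ℤ)) * ∑ i ∈ range (c.sizeUpTo l), deg i)).negOnePow •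
      m c.length (fun l => f (c.blocksFun l) (fun j => a (c.sizeUpTo l + j)))

theorem innerTerm_eq_zero {k : Type u} {A : Type v} {B : Type w} [Field k] [AddCommGroup A]
    [Module k A] [AddCommGroup B] [Module k B]
    (m : (s : ℕ) → MultilinearMap k (fun _ : Fin s => A) A)
    (f : (s : ℕ) → MultilinearMap k (fun _ : Fin s => A) B) (a : ℕ → A) (deg : ℕ → ℤ)
    (r s t : ℕ) (hm : m s = 0) : innerTerm m f a deg r s t = 0 := by
  rw [innerTerm, hm, zero_apply,
    (f (r + 1 + t)).map_coord_zero ⟨r, by omega⟩ (by simp [replaceBlock]), smul_zero]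

theorem innerSum_one {k : Type u} {A : Type v} {B : Type w} [Field k] [AddCommGroup A]
    [Module k A] [AddCommGroup B] [Module k B]
    (m : (s : ℕ) → MultilinearMap k (fun _ : Fin s => A) A) (hm : m 0 = 0)
    (f : (s : ℕ) → MultilinearMap k (fun _ : Fin s => A) B) (x : A) (deg : ℕ → ℤ) :
    innerSum m f 1 (fun _ => x) deg = f 1 (fun _ => m 1 (fun _ => x)) := by
  have h1 : innerTerm m f (fun _ => x) deg 0 1 0 = f 1 (fun _ => m 1 (fun _ => x)) := by
    rw [innerTerm]
    simp only [range_zero, sum_empty]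
    have : (fun i : Fin (0 + 1 + 0) => replaceBlock (fun _ => x) 0 1 (m 1 fun _ => x) i)
        = fun _ => m 1 (fun _ => x) := by
      funext i; obtain rfl : i = (0 : Fin 1) := Subsingleton.elim (α := Fin 1) _ _; rfl
    rw [this]; simp
  simp [innerSum, Finset.Nat.antidiagonal_succ, innerTerm_eq_zero m f _ deg _ 0 _ hm, h1]

theorem outerSum_one {k : Type u} {A : Type v} {B : Type w} [Field k] [AddCommGroup A]
    [Module k A] [AddCommGroup B] [Module k B]
    (m : (s : ℕ) → MultilinearMap k (fun _ : Fin s => B) B)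
    (f : (s : ℕ) → MultilinearMap k (fun _ : Fin s => A) B) (x : A) (deg : ℕ → ℤ) :
    outerSum m f 1 (fun _ => x) deg = m 1 (fun _ => f 1 (fun _ => x)) := by
  have hs : Subsingleton (Composition 1) :=
    Fintype.card_le_one_iff_subsingleton.mp (by simp [composition_card])
  rw [outerSum, Fintype.sum_subsingleton _ (Composition.ones 1)]
  change (∑ l : Fin 1, (((1 : ℕ) : ℤ) - 1 - (l : ℕ)) * _ + _ : ℤ).negOnePow • m 1 _ = _
  simp only [Fin.sum_univ_one, Nat.cast_one, sub_self, Fin.val_zero, Nat.cast_zero, zero_mul,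
    zero_add]
  have hf : (fun l : Fin 1 => f ((Composition.ones 1).blocksFun l) fun _ => x)
      = fun _ => f 1 (fun _ => x) := by
    funext l; obtain rfl : l = 0 := Subsingleton.elim _ _; rfl
  change _ • m 1 (fun l : Fin 1 => f ((Composition.ones 1).blocksFun l) fun _ => x) = _
  rw [hf]
  simp

/-- An `A∞`-algebra: operations `m_s : A^{⊗s} → A` of degree `2 - s` for `s ≥ 1` (the value at
`s = 0` is `0`) with `∑_{r+s+t=n} (-1)^{r+st} m_{r+1+t} (1^{⊗r} ⊗ m_s ⊗ 1^{⊗t}) = 0`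
for all `n`. The differential is `m₁`. -/
structure AInftyAlgebra (k : Type u) (A : Type v) [Field k] [AddCommGroup A] [Module k A]
    extends GradedSpace k A where
  m : (s : ℕ) → MultilinearMap k (fun _ : Fin s => A) A
  m_zero : m 0 = 0
  m_mem : ∀ (s : ℕ) (x : Fin s → A) (n : Fin s → ℤ), (∀ i, x i ∈ gr (n i)) →
    m s x ∈ gr (∑ i, n i + 2 - s)
  stasheff : ∀ (n : ℕ) (a : ℕ → A) (deg : ℕ → ℤ), (∀ i, a i ∈ gr (deg i)) →
    innerSum m m n a deg = 0

/-- A filtered `A∞`-algebra. -/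
structure FilteredAInftyAlgebra (k : Type u) (A : Type v) [Field k] [AddCommGroup A]
    [Module k A] extends AInftyAlgebra k A, FilteredSpace k A where
  m_F : ∀ (s : ℕ) (x : Fin s → A) (p n : Fin s → ℤ), (∀ i, x i ∈ F (p i) (n i)) →
    m s x ∈ F (∑ i, p i) (∑ i, n i + 2 - s)

/-- A morphism of `A∞`-algebras: maps `f_s : A^{⊗s} → B` of degree `1 - s` for `s ≥ 1` (the value
at `s = 0` is `0`) with
`∑_{r+s+t=n} (-1)^{r+st} f_{r+1+t} (1^{⊗r} ⊗ m_s ⊗ 1^{⊗t})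
  = ∑_{i₁+⋯+i_r=n} (-1)^{∑ₗ (r-l)(i_l-1)} m_r (f_{i₁} ⊗ ⋯ ⊗ f_{i_r})` for all `n`. -/
structure AInftyHom {k : Type u} {A : Type v} {B : Type w} [Field k] [AddCommGroup A]
    [Module k A] [AddCommGroup B] [Module k B]
    (M : AInftyAlgebra k A) (N : AInftyAlgebra k B) where
  f : (s : ℕ) → MultilinearMap k (fun _ : Fin s => A) B
  f_zero : f 0 = 0
  f_mem : ∀ (s : ℕ) (x : Fin s → A) (n : Fin s → ℤ), (∀ i, x i ∈ M.gr (n i)) →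
    f s x ∈ N.gr (∑ i, n i + 1 - s)
  rel : ∀ (n : ℕ) (a : ℕ → A) (deg : ℕ → ℤ), (∀ i, a i ∈ M.gr (deg i)) →
    innerSum M.m f n a deg = outerSum N.m f n a deg

/-- A filtered morphism of filtered `A∞`-algebras. -/
structure FilteredAInftyHom {k : Type u} {A : Type v} {B : Type w} [Field k] [AddCommGroup A]
    [Module k A] [AddCommGroup B] [Module k B]
    (M : FilteredAInftyAlgebra k A) (N : FilteredAInftyAlgebra k B)
    extends AInftyHom M.toAInftyAlgebra N.toAInftyAlgebra where
  f_F : ∀ (s : ℕ) (x : Fin s → A) (p n : Fin s → ℤ), (∀ i, x i ∈ M.F (p i) (n i)) →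
    f s x ∈ N.F (∑ i, p i) (∑ i, n i + 1 - s)

namespace FilteredAInftyAlgebra

variable {k : Type u} {A : Type v} [Field k] [AddCommGroup A] [Module k A]

theorem m_one_m_one (M : FilteredAInftyAlgebra k A) (x : A) :
    M.m 1 (fun _ => M.m 1 (fun _ => x)) = 0 := by
  have key : ∀ n, ∀ x ∈ M.gr n, M.m 1 (fun _ => M.m 1 (fun _ => x)) = 0 := by
    intro n x hx
    have h := M.stasheff 1 (fun _ => x) (fun _ => n) (fun _ => hx)
    rwa [innerSum_one M.m M.m_zero] at h
  let δ : A →ₗ[k] A := (MultilinearMap.ofSubsingleton k A A (0 : Fin 1)).symm (M.m 1)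
  have hδ : ∀ y, δ y = M.m 1 (fun _ => y) := fun y => rfl
  have hx : x ∈ ⨆ n, M.gr n := by
    rw [M.isInternal.submodule_iSup_eq_top]; trivial
  rw [← hδ, ← hδ]
  induction hx using Submodule.iSup_induction' with
  | mem n x hx => exact key n x hx
  | zero => simp
  | add x y _ _ hx hy => rw [map_add, map_add, hx, hy, add_zero]

/-- The underlying filtered complex of a filtered `A∞`-algebra, with differential `m₁`. -/
def toFilteredComplex (M : FilteredAInftyAlgebra k A) : FilteredComplex k A where
  toFilteredSpace := M.toFilteredSpace
  d := (MultilinearMap.ofSubsingleton k A A (0 : Fin 1)).symm (M.m 1)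
  d_mem n x hx := by
    have h := M.m_mem 1 (fun _ => x) (fun _ => n) (fun _ => hx)
    rw [show ∑ _i : Fin 1, n + 2 - ((1 : ℕ) : ℤ) = n + 1 by simp; ring] at h
    exact h
  d_d x := M.m_one_m_one x
  d_F p n x hx := by
    have h := M.m_F 1 (fun _ => x) (fun _ => p) (fun _ => n) (fun _ => hx)
    rw [show ∑ _i : Fin 1, n + 2 - ((1 : ℕ) : ℤ) = n + 1 by simp; ring,
      show ∑ _i : Fin 1, p = p by simp] at h
    exact h

end FilteredAInftyAlgebra

namespace FilteredAInftyHom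

variable {k : Type u} {A : Type v} {B : Type w} [Field k] [AddCommGroup A] [Module k A]
  [AddCommGroup B] [Module k B] {M : FilteredAInftyAlgebra k A} {N : FilteredAInftyAlgebra k B}

theorem f_one_m_one (φ : FilteredAInftyHom M N) (x : A) :
    φ.f 1 (fun _ => M.m 1 (fun _ => x)) = N.m 1 (fun _ => φ.f 1 (fun _ => x)) := by
  have key : ∀ n, ∀ x ∈ M.gr n,
      φ.f 1 (fun _ => M.m 1 (fun _ => x)) = N.m 1 (fun _ => φ.f 1 (fun _ => x)) := by
    intro n x hx
    have h := φ.rel 1 (fun _ => x) (fun _ => n) (fun _ => hx)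
    rwa [innerSum_one M.m M.m_zero, outerSum_one] at h
  let δ : A →ₗ[k] A := (MultilinearMap.ofSubsingleton k A A (0 : Fin 1)).symm (M.m 1)
  let ε : B →ₗ[k] B := (MultilinearMap.ofSubsingleton k B B (0 : Fin 1)).symm (N.m 1)
  let g : A →ₗ[k] B := (MultilinearMap.ofSubsingleton k A B (0 : Fin 1)).symm (φ.f 1)
  have hx : x ∈ ⨆ n, M.gr n := by
    rw [M.isInternal.submodule_iSup_eq_top]; trivial
  change g (δ x) = ε (g x)
  induction hx using Submodule.iSup_induction' with
  | mem n x hx => exact key n x hx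
  | zero => simp
  | add x y _ _ hx hy => rw [map_add, map_add, map_add, map_add, hx, hy]

/-- The linear part `f₁` of a filtered `A∞`-morphism, a morphism of filtered complexes. -/
def linearPart (φ : FilteredAInftyHom M N) :
    FilteredComplex.Hom M.toFilteredComplex N.toFilteredComplex where
  f := (MultilinearMap.ofSubsingleton k A B (0 : Fin 1)).symm (φ.f 1)
  f_mem n x hx := by
    have h := φ.f_mem 1 (fun _ => x) (fun _ => n) (fun _ => hx)
    rw [show ∑ _i : Fin 1, n + 1 - ((1 : ℕ) : ℤ) = n by simp] at h
    exact h
  f_F p n x hx := by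
    have h := φ.f_F 1 (fun _ => x) (fun _ => p) (fun _ => n) (fun _ => hx)
    rw [show ∑ _i : Fin 1, n + 1 - ((1 : ℕ) : ℤ) = n by simp,
      show ∑ _i : Fin 1, p = p by simp] at h
    exact h
  f_d x := φ.f_one_m_one x

/-- A filtered `A∞`-morphism is a filtered quasi-isomorphism if `f₁` is one. -/
def IsFilteredQuasiIso (φ : FilteredAInftyHom M N) : Prop :=
  φ.linearPart.IsFilteredQuasiIso

end FilteredAInftyHom

namespace FilteredDGAlgebra

variable {k : Type u} {A : Type v} [Field k] [AddCommGroup A] [Module k A]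

/-- The operations of a dg-algebra: `m₁ = d`, `m₂` is the product and all others vanish. -/
def ops (A' : FilteredDGAlgebra k A) : (s : ℕ) → MultilinearMap k (fun _ : Fin s => A) A
  | 1 => MultilinearMap.ofSubsingleton k A A (0 : Fin 1) A'.d
  | 2 => MultilinearMap.mk' (fun x : Fin 2 → A => A'.mul (x 0) (x 1))
      (by intro x i a b; fin_cases i <;> simp)
      (by intro x i c a; fin_cases i <;> simp)
  | _ => 0

theorem ops_one (A' : FilteredDGAlgebra k A) (x : Fin 1 → A) : A'.ops 1 x = A'.d (x 0) := rfl

theorem ops_two (A' : FilteredDGAlgebra k A) (x : Fin 2 → A) :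
    A'.ops 2 x = A'.mul (x 0) (x 1) := rfl

theorem ops_of_three_le (A' : FilteredDGAlgebra k A) {s : ℕ} (hs : 3 ≤ s) : A'.ops s = 0 := by
  obtain ⟨t, rfl⟩ := Nat.exists_eq_add_of_le' hs
  rfl

/-- A filtered dg-algebra, seen as a filtered `A∞`-algebra. -/
def toFilteredAInfty (A' : FilteredDGAlgebra k A) : FilteredAInftyAlgebra k A where
  toFilteredSpace := A'.toFilteredSpace
  m := A'.ops
  m_zero := rfl
  m_mem s x n hx := by
    match s with
    | 0 => exact Submodule.zero_mem _
    | 1 =>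
      have h := A'.d_mem _ _ (hx 0)
      rw [show ∑ i, n i + 2 - ((1 : ℕ) : ℤ) = n 0 + 1 by simp; ring]
      exact h
    | 2 =>
      have h := A'.mul_mem _ _ _ (hx 0) _ (hx 1)
      rw [show ∑ i, n i + 2 - ((2 : ℕ) : ℤ) = n 0 + n 1 by simp]
      exact h
    | s + 3 => exact Submodule.zero_mem _
  stasheff n a deg ha := by
    have h0 : ∀ r t, innerTerm A'.ops A'.ops a deg r 0 t = 0 := fun r t =>
      innerTerm_eq_zero _ _ a deg r 0 t rfl
    match n with
    | 0 => simp [innerSum, h0]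
    | 1 =>
      simp [innerSum, Finset.Nat.antidiagonal_succ, h0]
      simp [innerTerm, ops_one, replaceBlock, A'.d_d]
    | 2 =>
      simp [innerSum, Finset.Nat.antidiagonal_succ, h0]
      simp [innerTerm, ops_one, ops_two, replaceBlock]
      rw [A'.leibniz _ _ (ha 0), add_comm 1 (deg 0), Int.negOnePow_succ, Units.neg_smul]
      abel
    | 3 =>
      simp [innerSum, Finset.Nat.antidiagonal_succ, h0]
      simp [innerTerm, ops_one, ops_two, ops_of_three_le, replaceBlock]
      rw [Int.negOnePow_even 2 (by decide), Int.negOnePow_odd (1 + 2 * deg 0) (by simp),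
        A'.mul_assoc]
      simp
    | n + 4 =>
      refine Finset.sum_eq_zero fun x hx => Finset.sum_eq_zero fun y hy => ?_
      rw [HasAntidiagonal.mem_antidiagonal] at hx hy
      by_cases hs : 3 ≤ y.1
      · exact innerTerm_eq_zero _ _ a deg _ _ _ (A'.ops_of_three_le hs)
      · rw [innerTerm, A'.ops_of_three_le (s := x.1 + 1 + y.2) (by omega),
          zero_apply, smul_zero]
  m_F s x p n hx := by
    match s with
    | 0 => exact Submodule.zero_mem _
    | 1 =>
      have h := A'.d_F _ _ _ (hx 0)
      rw [show ∑ i, n i + 2 - ((1 : ℕ) : ℤ) = n 0 + 1 by simp; ring,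
        show ∑ i, p i = p 0 by simp]
      exact h
    | 2 =>
      have h := A'.mul_F _ _ _ _ _ (hx 0) _ (hx 1)
      rw [show ∑ i, n i + 2 - ((2 : ℕ) : ℤ) = n 0 + n 1 by simp,
        show ∑ i, p i = p 0 + p 1 by simp]
      exact h
    | s + 3 => exact Submodule.zero_mem _

end FilteredDGAlgebra

/-- A bigrading `M = ⨁ M^{p,q}` with `Fᵖ Mⁿ = ⨁_{q ≥ p} M^{q,n-q}` which makes the filtered
`A∞`-algebra `M` filtered minimal: `d (Fᵖ Mⁿ) ⊆ Fᵖ⁺¹ Mⁿ⁺¹`. -/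
structure FilteredAInftyAlgebra.MinimalBigrading {k : Type u} {A : Type v} [Field k]
    [AddCommGroup A] [Module k A] (M : FilteredAInftyAlgebra k A) where
  bigr : ℤ → ℤ → Submodule k A
  bigr_isInternal : DirectSum.IsInternal (fun x : ℤ × ℤ => bigr x.1 x.2)
  bigr_le : ∀ p q, bigr p q ≤ M.gr (p + q)
  F_eq : ∀ p n, M.F p n = ⨆ q ∈ Set.Ici p, bigr q (n - q)
  d_F_succ : ∀ p n, ∀ x ∈ M.F p n, M.toFilteredComplex.d x ∈ M.F (p + 1) (n + 1)

/-- A filtered minimal `A∞`-model of a filtered dg-algebra `A`: a filtered minimal `A∞`-algebra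
`M` with a filtered `A∞`-morphism `M → A` which is a filtered quasi-isomorphism. -/
structure FilteredDGAlgebra.MinimalModel {k : Type u} {A : Type v} [Field k]
    [AddCommGroup A] [Module k A] (A' : FilteredDGAlgebra k A) where
  carrier : Type v
  [addCommGroup : AddCommGroup carrier]
  [module : Module k carrier]
  alg : FilteredAInftyAlgebra k carrier
  bigrading : alg.MinimalBigrading
  hom : FilteredAInftyHom alg A'.toFilteredAInfty
  isFilteredQuasiIso : hom.IsFilteredQuasiIso

attribute [instance] FilteredDGAlgebra.MinimalModel.addCommGroup
  FilteredDGAlgebra.MinimalModel.module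

/-!
The model is obtained by filtered homotopy transfer along a contraction that exists because `k` is
a field.

**Linear part.** Choose `L p n` complementary to `{x ∈ Fᵖ Aⁿ | d x ∈ Fᵖ⁺¹}` in `Fᵖ Aⁿ`. The
differential maps `L p n` isomorphically onto the coboundaries of the associated graded complex.
Inverting it on `d (L p n)` gives a filtered map `H` of degree `-1` with `H² = 0`, `H d H = H` and
`d H d = d` up to higher filtration (`FilteredComplex.exists_contraction`). Then
`e = 1 - d H - H d` is an idempotent chain map, its image `M` consists of the `x` with
`H x = H d x = 0`, and for such `x ∈ Fᵖ` the element `d x = d x - d H d x` lies in `Fᵖ⁺¹`. So `M` is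
minimal, its inclusion is a filtered quasi-isomorphism with homotopy inverse `e`, and complements
of the filtration steps of `M` represent the first page.

**Transfer.** In suspended notation, a morphism from an `A∞`-algebra with operations `b` to a
dg-algebra is a function `f` on words with `d f - f ∘ b̂ + f ∪ f = 0`, where `b̂` inserts `b` into a
word in all possible ways and `(f ∪ f) w = ∑ ± f u · f v` over all `w = u ++ v`. With `letter` the
projection to words of length one, solve `f = letter - H (f ∪ f)` recursively in the length
and put `b = d letter + e (f ∪ f)`. If `R` is the left-hand side of the morphism equation, then
`R = H (d (f ∪ f) + (f ∪ f) ∘ b̂)`, and by the Leibniz rules and associativity the argument of `H`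
is a sum of products of values of `f` and of `R` on strictly shorter words; hence `R = 0` by
induction (`TransferData.f_isMorphism`). The argument of `H` therefore vanishes, and
`b ∘ b̂ = e (d (f ∪ f) + (f ∪ f) ∘ b̂)` because `e` is a chain map, so `b ∘ b̂ = 0`
(`TransferData.insertSum_b`). All this takes place on `A` itself, with `f₁ = id` and `b₁ = d`;
since `d` preserves `M` and `e` has image `M`, the operations restrict to `M`.

**Signs.** The Koszul signs on words are encoded by the operator `τ = (-1)^deg`. Evaluating on
`(τ^{s-1} a₀, …, τ a_{s-2}, a_{s-1})` turns the suspended operations into the unsuspended ones; on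
homogeneous elements all terms of both relations change by the common sign
`(-1)^{∑ (n-1-i) |aᵢ|}`.
-/

/-! ### Splitting a filtration -/

/-- A subspace `b ≤ c` which meets `a ≤ c` trivially extends to a complement of `a` in `c`. -/
theorem exists_relative_complement {k : Type u} {A : Type v} [Field k] [AddCommGroup A]
    [Module k A] {a b c : Submodule k A} (hac : a ≤ c) (hbc : b ≤ c) (hab : Disjoint a b) :
    ∃ g, b ≤ g ∧ a ⊔ g = c ∧ Disjoint a g := by
  obtain ⟨g, hbg, hg⟩ := hab.symm.exists_isCompl
  refine ⟨g ⊓ c, le_inf hbg hbc, ?_, hg.disjoint.symm.mono_right inf_le_left⟩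
  rw [← sup_inf_assoc_of_le g hac, sup_comm, hg.sup_eq_top, top_inf_eq]

theorem exists_linearMap_of_isInternal {k : Type u} {A : Type v} {B : Type w} [Field k]
    [AddCommGroup A] [Module k A] [AddCommGroup B] [Module k B] {ι : Type*} [DecidableEq ι]
    {G : ι → Submodule k A} (hG : DirectSum.IsInternal G) (φ : ι → A →ₗ[k] B) :
    ∃ f : A →ₗ[k] B, ∀ i, ∀ x ∈ G i, f x = φ i x := by
  refine ⟨(DirectSum.toModule k ι B fun i => φ i ∘ₗ (G i).subtype) ∘ₗ
    (LinearEquiv.ofBijective (DirectSum.coeLinearMap G) hG).symm.toLinearMap, ?_⟩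
  intro i x hx
  have : (LinearEquiv.ofBijective (DirectSum.coeLinearMap G) hG).symm x
      = DirectSum.lof k ι (fun i => G i) i ⟨x, hx⟩ := by
    rw [LinearEquiv.symm_apply_eq]
    exact (DirectSum.coeLinearMap_lof G i ⟨x, hx⟩).symm
  rw [LinearMap.comp_apply, LinearEquiv.coe_coe, this, DirectSum.toModule_lof]
  rfl

namespace GradedSpace

variable {k : Type u} {A : Type v} {B : Type w} [Field k] [AddCommGroup A] [Module k A]
  [AddCommGroup B] [Module k B] (S : GradedSpace k A)

theorem ext_homogeneous {f g : A →ₗ[k] B} (h : ∀ n, ∀ x ∈ S.gr n, f x = g x) (x : A) :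
    f x = g x := by
  have hx : x ∈ ⨆ n, S.gr n := by
    rw [S.isInternal.submodule_iSup_eq_top]; trivial
  induction hx using Submodule.iSup_induction' with
  | mem n x hx => exact h n x hx
  | zero => simp
  | add x y _ _ hx hy => rw [map_add, map_add, hx, hy]

/-- The grading induced on the subspace of fixed points of a homogeneous idempotent `e`. -/
def restrict (M : Submodule k A) (e : A →ₗ[k] A) (he : ∀ n, ∀ x ∈ S.gr n, e x ∈ S.gr n)
    (heM : ∀ x, e x ∈ M) (hfix : ∀ x ∈ M, e x = x) : GradedSpace k M where
  gr n := (S.gr n).comap M.subtype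
  isInternal := by
    rw [DirectSum.isInternal_submodule_iff_iSupIndep_and_iSup_eq_top]
    constructor
    · have h := S.isInternal.submodule_iSupIndep
      rw [iSupIndep_iff_finsetSum_eq_zero_imp_eq_zero] at h ⊢
      intro s v hv h0 i hi
      have := h s (fun i => (v i : A)) hv (by
        have := congrArg M.subtype h0
        simpa using this) i hi
      exact Subtype.ext this
    · rw [eq_top_iff]
      rintro ⟨x, hx⟩ -
      let E : A →ₗ[k] M := e.codRestrict M heM
      have hE : ∀ y, E y ∈ ⨆ n, (S.gr n).comap M.subtype := by
        intro y
        have hy : y ∈ ⨆ n, S.gr n := by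
          rw [S.isInternal.submodule_iSup_eq_top]; trivial
        induction hy using Submodule.iSup_induction' with
        | mem n y hy => exact Submodule.mem_iSup_of_mem n (he n y hy)
        | zero => simp
        | add x y _ _ hx hy => rw [map_add]; exact Submodule.add_mem _ hx hy
      have : E x = ⟨x, hx⟩ := Subtype.ext (hfix x hx)
      rw [← this]
      exact hE x

end GradedSpace

namespace FilteredSpace

variable {k : Type u} {A : Type v} [Field k] [AddCommGroup A] [Module k A]
  (S : FilteredSpace k A)

theorem F_antitone (n : ℤ) : Antitone fun p => S.F p n :=
  antitone_int_of_succ_le fun p => S.F_anti p n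

theorem F_of_le {p q : ℤ} (h : p ≤ q) {n : ℤ} {x : A} (hx : x ∈ S.F q n) : x ∈ S.F p n :=
  S.F_antitone n h hx

variable {S} {G : ℤ → ℤ → Submodule k A}

/-- If each `G p n` is a complement of `Fᵖ⁺¹ Aⁿ` in `Fᵖ Aⁿ`, then `Fᵖ Aⁿ` is the sum of
the `G q n` with `q ≥ p`, since the filtration is bounded below. -/
theorem F_eq_iSup (hsup : ∀ p n, S.F (p + 1) n ⊔ G p n = S.F p n) (p n : ℤ) :
    S.F p n = ⨆ q ∈ Set.Ici p, G q n := by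
  apply le_antisymm
  · obtain ⟨N, hN⟩ := S.F_bddBelow n
    have key : ∀ (j : ℕ) (p : ℤ), N ≤ p + j → S.F p n ≤ ⨆ q ∈ Set.Ici p, G q n := by
      intro j
      induction j with
      | zero =>
        intro p hp
        have := S.F_antitone n (show N ≤ p by simpa using hp)
        simp only [hN] at this
        exact this.trans bot_le
      | succ j ih =>
        intro p hp
        rw [← hsup p n]
        refine sup_le ((ih (p + 1) (by push_cast at hp; omega)).trans ?_) ?_
        · exact biSup_mono fun q hq => by
            simp only [Set.mem_Ici] at hq ⊢; omega
        · exact le_biSup (fun q => G q n) (Set.mem_Ici.mpr le_rfl)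
    exact key (N - p).toNat p (by omega)
  · refine iSup₂_le fun q hq => ?_
    exact (le_sup_right.trans (hsup q n).le).trans (S.F_antitone n hq)

theorem isInternal_of_complements (hsup : ∀ p n, S.F (p + 1) n ⊔ G p n = S.F p n)
    (hdis : ∀ p n, Disjoint (S.F (p + 1) n) (G p n)) :
    DirectSum.IsInternal fun x : ℤ × ℤ => G x.1 x.2 := by
  classical
  have hGF : ∀ p n, G p n ≤ S.F p n := fun p n => le_sup_right.trans (hsup p n).le
  rw [DirectSum.isInternal_submodule_iff_iSupIndep_and_iSup_eq_top]
  constructor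
  · have hgr := S.isInternal.submodule_iSupIndep
    rw [iSupIndep_iff_finsetSum_eq_zero_imp_eq_zero] at hgr ⊢
    -- Within one degree, the term of smallest filtration index lies in the next filtration step.
    have one : ∀ (n : ℤ) (s : Finset (ℤ × ℤ)) (v : ℤ × ℤ → A), (∀ i ∈ s, i.2 = n) →
        (∀ i ∈ s, v i ∈ G i.1 i.2) → ∑ i ∈ s, v i = 0 → ∀ i ∈ s, v i = 0 := by
      intro n s v
      induction s using Finset.induction_on_min_value (fun i : ℤ × ℤ => i.1) with
      | empty => simp
      | insert a s ha hmin ih =>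
        intro hn hv h0
        rw [Finset.sum_insert ha] at h0
        have han : a.2 = n := hn a (Finset.mem_insert_self _ _)
        have hva : v a ∈ G a.1 n := han ▸ hv a (Finset.mem_insert_self _ _)
        have hrest : ∑ i ∈ s, v i ∈ S.F (a.1 + 1) n := by
          refine Submodule.sum_mem _ fun i hi => ?_
          have hin : i.2 = n := hn i (Finset.mem_insert_of_mem hi)
          have hlt : a.1 < i.1 := by
            refine lt_of_le_of_ne (hmin i hi) fun h => ha ?_
            rwa [show a = i from Prod.ext h (han.trans hin.symm)]
          refine S.F_of_le (q := i.1) (by omega) (hGF _ _ ?_)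
          exact hin ▸ hv i (Finset.mem_insert_of_mem hi)
        have hva0 : v a = 0 := by
          refine Submodule.disjoint_def.mp (hdis a.1 n) _ ?_ hva
          rw [eq_neg_of_add_eq_zero_left h0]
          exact Submodule.neg_mem _ hrest
        rw [hva0, zero_add] at h0
        intro i hi
        rcases Finset.mem_insert.mp hi with rfl | hi
        · exact hva0
        · exact ih (fun i hi => hn i (Finset.mem_insert_of_mem hi))
            (fun i hi => hv i (Finset.mem_insert_of_mem hi)) h0 i hi
    intro s v hv h0 i hi
    have hsum : ∑ n ∈ s.image Prod.snd, ∑ j ∈ s with j.2 = n, v j = 0 := by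
      rw [Finset.sum_fiberwise_of_maps_to (fun j hj => Finset.mem_image_of_mem _ hj)]
      exact h0
    have := hgr _ _ (fun n _ => Submodule.sum_mem _ fun j hj => by
      obtain ⟨hjs, rfl⟩ := Finset.mem_filter.mp hj
      exact S.F_le _ _ (hGF _ _ (hv j hjs))) hsum i.2 (Finset.mem_image_of_mem _ hi)
    exact one i.2 _ v (fun j hj => (Finset.mem_filter.mp hj).2)
      (fun j hj => hv j (Finset.mem_filter.mp hj).1) this i (Finset.mem_filter.mpr ⟨hi, rfl⟩)
  · rw [eq_top_iff, ← S.isInternal.submodule_iSup_eq_top]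
    refine iSup_le fun n x hx => ?_
    obtain ⟨p, hp⟩ := S.F_exhaustive n x hx
    rw [F_eq_iSup hsup] at hp
    refine (iSup₂_le fun q _ => ?_ : (⨆ q ∈ Set.Ici p, G q n) ≤ _) hp
    exact le_iSup (fun x : ℤ × ℤ => G x.1 x.2) (q, n)

/-- The filtration induced on the subspace of fixed points of a filtered idempotent `e`. -/
def restrict (S : FilteredSpace k A) (M : Submodule k A) (e : A →ₗ[k] A)
    (he : ∀ n, ∀ x ∈ S.gr n, e x ∈ S.gr n)
    (heM : ∀ x, e x ∈ M) (hfix : ∀ x ∈ M, e x = x) : FilteredSpace k M where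
  toGradedSpace := S.toGradedSpace.restrict M e he heM hfix
  F p n := (S.F p n).comap M.subtype
  F_le p n := Submodule.comap_mono (S.F_le p n)
  F_anti p n := Submodule.comap_mono (S.F_anti p n)
  F_exhaustive n x hx := S.F_exhaustive n x hx
  F_bddBelow n := by
    obtain ⟨p, hp⟩ := S.F_bddBelow n
    exact ⟨p, by rw [hp, Submodule.comap_bot, Submodule.ker_subtype]⟩

end FilteredSpace

/-! ### A filtered contraction -/

namespace FilteredComplex

variable {k : Type u} {A : Type v} [Field k] [AddCommGroup A] [Module k A]

/-- A filtered contraction: a filtered map `H` of degree `-1` with `H² = 0` and `H d H = H`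
which inverts the differential of the associated graded complex in the sense that
`d H d = d` up to higher filtration. Then `d H + H d` is a chain projection onto a contractible
subcomplex, and its kernel is a complement with vanishing associated graded differential. -/
structure Contraction (C : FilteredComplex k A) where
  H : A →ₗ[k] A
  H_F : ∀ p n, ∀ x ∈ C.F p n, H x ∈ C.F p (n - 1)
  H_H : ∀ x, H (H x) = 0
  H_d_H : ∀ x, H (C.d (H x)) = H x
  d_sub_mem : ∀ p n, ∀ x ∈ C.F p n, C.d x - C.d (H (C.d x)) ∈ C.F (p + 1) (n + 1)

theorem exists_contraction (C : FilteredComplex k A) : Nonempty C.Contraction := by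
  classical
  let P : ℤ → ℤ → Submodule k A := fun p n => C.F p n ⊓ (C.F (p + 1) (n + 1)).comap C.d
  -- `L p n` maps isomorphically onto the coboundaries of the associated graded complex.
  have hL : ∀ p n, ∃ L, P p n ⊔ L = C.F p n ∧ Disjoint (P p n) L := fun p n => by
    obtain ⟨g, -, h⟩ := exists_relative_complement (a := P p n) (b := ⊥) (c := C.F p n)
      inf_le_left bot_le disjoint_bot_right
    exact ⟨g, h⟩
  choose L hLsup hLdis using hL
  have hLF : ∀ p n, L p n ≤ C.F p n := fun p n => le_sup_right.trans (hLsup p n).le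
  have hL0 : ∀ p n, ∀ l ∈ L p n, C.d l ∈ C.F (p + 1) (n + 1) → l = 0 := fun p n l hl hd =>
    Submodule.disjoint_def.mp (hLdis p n) l ⟨hLF p n hl, hd⟩ hl
  have hdL0 : ∀ p m n, m + 1 = n → ∀ l ∈ L p m, ∀ l' ∈ L p n,
      C.d l + l' ∈ C.F (p + 1) n → l = 0 ∧ l' = 0 := by
    rintro p m n rfl l hl l' hl' h
    have h' : l' = 0 := by
      refine hL0 _ _ _ hl' ?_
      have := C.d_F _ _ _ h
      rwa [map_add, C.d_d, zero_add] at this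
    rw [h', add_zero] at h
    exact ⟨hL0 _ _ _ hl h, h'⟩
  have hH : ∀ p n, ∃ H : A →ₗ[k] A, (∀ l ∈ L p (n - 1), H (C.d l) = l) ∧
      (∀ l ∈ L p n, H l = 0) ∧ ∀ x, H x ∈ L p (n - 1) := by
    intro p n
    let f : L p (n - 1) →ₗ[k] A ⧸ L p n := (L p n).mkQ ∘ₗ C.d ∘ₗ (L p (n - 1)).subtype
    have hf : LinearMap.ker f = ⊥ := by
      rw [LinearMap.ker_eq_bot']
      rintro ⟨l, hl⟩ h
      have h : C.d l ∈ L p n := (Submodule.Quotient.mk_eq_zero _).mp h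
      refine Subtype.ext (hdL0 p (n - 1) n (by omega) l hl (-C.d l) (Submodule.neg_mem _ h) ?_).1
      rw [add_neg_cancel]
      exact Submodule.zero_mem _
    obtain ⟨g, hg⟩ := f.exists_leftInverse_of_injective hf
    refine ⟨(L p (n - 1)).subtype ∘ₗ g ∘ₗ (L p n).mkQ, fun l hl => ?_, fun l hl => ?_,
      fun x => (g _).2⟩
    · exact congrArg Subtype.val (LinearMap.congr_fun hg ⟨l, hl⟩)
    · simp [(Submodule.Quotient.mk_eq_zero _).mpr hl]
  choose η hηd hηL hηmem using hH
  have hG : ∀ p n, ∃ G, L p n ⊔ (L p (n - 1)).map C.d ≤ G ∧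
      C.F (p + 1) n ⊔ G = C.F p n ∧ Disjoint (C.F (p + 1) n) G := by
    intro p n
    refine exists_relative_complement (C.F_anti p n) (sup_le (hLF p n) ?_) ?_
    · rintro _ ⟨l, hl, rfl⟩
      have := C.d_F _ _ _ (hLF _ _ hl)
      rwa [sub_add_cancel] at this
    · rw [Submodule.disjoint_def]
      intro x hx hx'
      obtain ⟨l', hl', _, ⟨l, hl, rfl⟩, rfl⟩ := Submodule.mem_sup.mp hx'
      rw [add_comm l'] at hx
      obtain ⟨rfl, rfl⟩ := hdL0 p (n - 1) n (by omega) l hl l' hl' hx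
      simp
  choose G hLG hGsup hGdis using hG
  have hGint := FilteredSpace.isInternal_of_complements hGsup hGdis
  obtain ⟨H, hH⟩ := exists_linearMap_of_isInternal hGint fun x => η x.1 x.2
  have hH : ∀ p n, ∀ x ∈ G p n, H x = η p n x := fun p n => hH (p, n)
  have hHL : ∀ p n, ∀ l ∈ L p n, H l = 0 := fun p n l hl => by
    rw [hH p n l (hLG p n (Submodule.mem_sup_left hl)), hηL p n l hl]
  have hHd : ∀ p n, ∀ l ∈ L p n, H (C.d l) = l := fun p n l hl => by
    obtain ⟨m, rfl⟩ : ∃ m, n = m - 1 := ⟨n + 1, by omega⟩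
    rw [hH p m _ (hLG p m (Submodule.mem_sup_right ⟨l, hl, rfl⟩)), hηd p m l hl]
  have hind : ∀ {f : A →ₗ[k] A}, (∀ p n, ∀ x ∈ G p n, f x = 0) → ∀ x, f x = 0 := by
    intro f hf x
    have hx : x ∈ ⨆ y : ℤ × ℤ, G y.1 y.2 := by
      rw [hGint.submodule_iSup_eq_top]; trivial
    induction hx using Submodule.iSup_induction' with
    | mem n x hx => exact hf _ _ x hx
    | zero => simp
    | add x y _ _ hx hy => rw [map_add, hx, hy, add_zero]
  have hHF : ∀ p n, ∀ x ∈ C.F p n, H x ∈ C.F p (n - 1) := by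
    intro p n x hx
    rw [FilteredSpace.F_eq_iSup hGsup] at hx
    refine (iSup₂_le fun q hq y hy => ?_ :
      (⨆ q ∈ Set.Ici p, G q n) ≤ (C.F p (n - 1)).comap H) hx
    rw [Submodule.mem_comap, hH q n y hy]
    exact C.F_of_le hq (hLF _ _ (hηmem q n y))
  refine ⟨⟨H, hHF, hind (f := H ∘ₗ H) fun p n x hx => ?_, fun x => ?_, ?_⟩⟩
  · rw [LinearMap.comp_apply, hH p n x hx, hHL _ _ _ (hηmem p n x)]
  · refine sub_eq_zero.mp (hind (f := H ∘ₗ C.d ∘ₗ H - H) (fun p n x hx => ?_) x)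
    rw [LinearMap.sub_apply, LinearMap.comp_apply, LinearMap.comp_apply, hH p n x hx,
      hHd _ _ _ (hηmem p n x), sub_self]
  · intro p n x hx
    rw [← hLsup p n] at hx
    obtain ⟨z, ⟨hz, hdz⟩, l, hl, rfl⟩ := Submodule.mem_sup.mp hx
    replace hdz : C.d z ∈ C.F (p + 1) (n + 1) := hdz
    have : C.d (z + l) - C.d (H (C.d (z + l))) = C.d z - C.d (H (C.d z)) := by
      rw [map_add, map_add, hHd p n l hl, map_add]; abel
    rw [this]
    have h := C.d_F _ _ _ (hHF _ _ _ hdz)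
    rw [sub_add_cancel] at h
    exact Submodule.sub_mem _ hdz h

namespace Contraction

variable {C : FilteredComplex k A} (h : C.Contraction)

theorem H_gr (n : ℤ) (x : A) (hx : x ∈ C.gr n) : h.H x ∈ C.gr (n - 1) := by
  obtain ⟨p, hp⟩ := C.F_exhaustive n x hx
  exact C.F_le _ _ (h.H_F _ _ _ hp)

/-- The chain map `1 - d H - H d`, the projection onto the minimal part. -/
def proj : A →ₗ[k] A := LinearMap.id - C.d ∘ₗ h.H - h.H ∘ₗ C.d

theorem proj_apply (x : A) : h.proj x = x - C.d (h.H x) - h.H (C.d x) := rfl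

theorem proj_d (x : A) : h.proj (C.d x) = C.d (h.proj x) := by
  simp [proj_apply, C.d_d]

/-- The subcomplex on which the homotopy `H` and `H d` vanish; it is the image of the
projection `1 - d H - H d`. -/
def minimalPart : Submodule k A := LinearMap.ker h.H ⊓ LinearMap.ker (h.H ∘ₗ C.d)

theorem proj_mem (x : A) : h.proj x ∈ h.minimalPart := by
  constructor
  · simp [proj_apply, h.H_d_H, h.H_H]
  · simp [proj_apply, h.H_d_H, C.d_d]

theorem proj_eq_self {x : A} (hx : x ∈ h.minimalPart) : h.proj x = x := by
  obtain ⟨h1, h2⟩ := hx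
  have h1 : h.H x = 0 := h1
  have h2 : h.H (C.d x) = 0 := h2
  simp [proj_apply, h1, h2]

theorem d_mem_minimalPart {x : A} (hx : x ∈ h.minimalPart) : C.d x ∈ h.minimalPart :=
  ⟨hx.2, by simp [C.d_d]⟩

theorem proj_F (p n : ℤ) (x : A) (hx : x ∈ C.F p n) : h.proj x ∈ C.F p n := by
  have h1 := C.d_F _ _ _ (h.H_F _ _ _ hx)
  have h2 := h.H_F _ _ _ (C.d_F _ _ _ hx)
  rw [sub_add_cancel] at h1
  rw [add_sub_cancel_right] at h2
  exact Submodule.sub_mem _ (Submodule.sub_mem _ hx h1) h2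

theorem proj_gr (n : ℤ) (x : A) (hx : x ∈ C.gr n) : h.proj x ∈ C.gr n := by
  obtain ⟨p, hp⟩ := C.F_exhaustive n x hx
  exact C.F_le _ _ (h.proj_F _ _ _ hp)

/-- The minimal part, as a filtered graded space. -/
def filteredSpace : FilteredSpace k h.minimalPart :=
  C.toFilteredSpace.restrict h.minimalPart h.proj h.proj_gr h.proj_mem fun _ => h.proj_eq_self

theorem d_F_succ (p n : ℤ) (x : A) (hx : x ∈ C.F p n) (hM : x ∈ h.minimalPart) :
    C.d x ∈ C.F (p + 1) (n + 1) := by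
  have := h.d_sub_mem p n x hx
  rwa [show h.H (C.d x) = 0 from hM.2, map_zero, sub_zero] at this

end Contraction

end FilteredComplex

/-! ### Sums over decompositions of words -/

section Words

variable {A : Type v} {X : Type w} [AddCommGroup X]

/-- The sum of `G u v` over all ways to write a word `w` as a concatenation `u ++ v`. -/
def splitSum (G : List A → List A → X) : List A → X
  | [] => G [] []
  | a :: w => G [] (a :: w) + splitSum (fun u v => G (a :: u) v) w

/-- The sum of `G (σ u ++ b v :: x)` over all ways to write a word as `u ++ v ++ x`. This is
`G` composed with the coderivation of the tensor coalgebra given by `b`, if `σ` is the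
Koszul sign for moving `b` past a letter. -/
def insertSum (σ : A → A) (b : List A → A) (G : List A → X) (w : List A) : X :=
  splitSum (fun u y => splitSum (fun v x => G (u.map σ ++ b v :: x)) y) w

theorem splitSum_congr {G G' : List A → List A → X} {w : List A}
    (h : ∀ u v, u ++ v = w → G u v = G' u v) : splitSum G w = splitSum G' w := by
  induction w generalizing G G' with
  | nil => exact h [] [] rfl
  | cons a w ih =>
    rw [splitSum, splitSum, h [] _ rfl, ih fun u v huv => h (a :: u) v (by simp [huv])]

theorem splitSum_add (G G' : List A → List A → X) (w : List A) :
    splitSum (fun u v => G u v + G' u v) w = splitSum G w + splitSum G' w := by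
  induction w generalizing G G' with
  | nil => rfl
  | cons a w ih => rw [splitSum, splitSum, splitSum, ih]; abel

theorem splitSum_zero (w : List A) : splitSum (fun _ _ : List A => (0 : X)) w = 0 := by
  induction w with
  | nil => rfl
  | cons a w ih => rw [splitSum, ih, add_zero]

theorem map_splitSum {Y : Type*} [AddCommGroup Y] {Φ : Type*} [FunLike Φ X Y]
    [AddMonoidHomClass Φ X Y] (L : Φ) (G : List A → List A → X) (w : List A) :
    L (splitSum G w) = splitSum (fun u v => L (G u v)) w := by
  induction w generalizing G with
  | nil => rfl
  | cons a w ih => rw [splitSum, splitSum, map_add, ih]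

theorem splitSum_neg (G : List A → List A → X) (w : List A) :
    splitSum (fun u v => -G u v) w = -splitSum G w :=
  (map_splitSum (negAddMonoidHom : X →+ X) G w).symm

theorem splitSum_sub (G G' : List A → List A → X) (w : List A) :
    splitSum (fun u v => G u v - G' u v) w = splitSum G w - splitSum G' w := by
  simp only [sub_eq_add_neg, splitSum_add, splitSum_neg]

theorem splitSum_map (σ : A → A) (G : List A → List A → X) (w : List A) :
    splitSum G (w.map σ) = splitSum (fun u v => G (u.map σ) (v.map σ)) w := by
  induction w generalizing G with
  | nil => rfl
  | cons a w ih => rw [List.map_cons, splitSum, splitSum, ih]; rfl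

/-- A word with a marked letter is cut before or after that letter. -/
theorem splitSum_append_cons (G : List A → List A → X) (u : List A) (c : A) (x : List A) :
    splitSum G (u ++ c :: x) = splitSum (fun u₁ u₂ => G u₁ (u₂ ++ c :: x)) u +
      splitSum (fun x₁ x₂ => G (u ++ c :: x₁) x₂) x := by
  induction u generalizing G with
  | nil => rfl
  | cons a u ih => rw [List.cons_append, splitSum, splitSum, ih, add_assoc]; rfl

/-- Coassociativity of deconcatenation. -/
theorem splitSum_assoc (K : List A → List A → List A → X) (w : List A) :
    splitSum (fun z y => splitSum (fun u v => K u v y) z) w =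
      splitSum (fun u z => splitSum (fun v y => K u v y) z) w := by
  induction w generalizing K with
  | nil => rfl
  | cons a w ih =>
    simp only [splitSum]
    rw [splitSum_add, ih fun u v y => K (a :: u) v y, add_assoc]

theorem splitSum_eq_right {G : List A → List A → X} (h : ∀ a u v, G (a :: u) v = 0)
    (w : List A) : splitSum G w = G [] w := by
  cases w with
  | nil => rfl
  | cons a w => simp only [splitSum, h, splitSum_zero, add_zero]

theorem splitSum_eq_left {G : List A → List A → X} (h : ∀ u a v, G u (a :: v) = 0)
    (w : List A) : splitSum G w = G w [] := by
  induction w generalizing G with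
  | nil => rfl
  | cons a w ih => rw [splitSum, h, zero_add, ih fun u => h (a :: u)]

variable (σ : A → A) (b : List A → A)

theorem map_insertSum {Y : Type*} [AddCommGroup Y] {Φ : Type*} [FunLike Φ X Y]
    [AddMonoidHomClass Φ X Y] (L : Φ) (G : List A → X) (w : List A) :
    L (insertSum σ b G w) = insertSum σ b (fun u => L (G u)) w := by
  simp only [insertSum, map_splitSum]

theorem insertSum_add (G G' : List A → X) (w : List A) :
    insertSum σ b (fun u => G u + G' u) w = insertSum σ b G w + insertSum σ b G' w := by
  simp only [insertSum, splitSum_add]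

theorem insertSum_sub (G G' : List A → X) (w : List A) :
    insertSum σ b (fun u => G u - G' u) w = insertSum σ b G w - insertSum σ b G' w := by
  simp only [insertSum, splitSum_sub]

/-- The co-Leibniz rule: an operation inserted into a word and followed by a cut is inserted
either before or after the cut. -/
theorem insertSum_splitSum (G : List A → List A → X) (w : List A) :
    insertSum σ b (splitSum G) w =
      splitSum (fun u v => insertSum σ b (fun z => G z v) u) w +
      splitSum (fun u v => insertSum σ b (fun z => G (u.map σ) z) v) w := by
  have h1 : splitSum (fun u v => insertSum σ b (fun z => G z v) u) w =
      splitSum (fun u y => splitSum (fun v x =>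
        splitSum (fun x₁ x₂ => G (u.map σ ++ b v :: x₁) x₂) x) y) w := by
    simp only [insertSum]
    rw [splitSum_assoc (fun u z v => splitSum (fun v' x => G (u.map σ ++ b v' :: x) v) z)]
    refine splitSum_congr fun u y _ => ?_
    exact splitSum_assoc (fun v' x v => G (u.map σ ++ b v' :: x) v) y
  have h2 : splitSum (fun u v => insertSum σ b (fun z => G (u.map σ) z) v) w =
      splitSum (fun u y => splitSum (fun v x =>
        splitSum (fun u₁ u₂ => G (u₁.map σ) (u₂.map σ ++ b v :: x)) u) y) w := by
    simp only [insertSum]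
    rw [← splitSum_assoc (fun u u' y => splitSum (fun v x =>
      G (u.map σ) (u'.map σ ++ b v :: x)) y)]
    refine splitSum_congr fun u y _ => ?_
    -- The two independent sums over `u` and over `y` are interchanged.
    have swap : ∀ (K : List A → List A → List A → List A → X) (u y : List A),
        splitSum (fun u₁ u₂ => splitSum (fun v x => K u₁ u₂ v x) y) u =
          splitSum (fun v x => splitSum (fun u₁ u₂ => K u₁ u₂ v x) u) y := by
      intro K u y
      induction u generalizing K with
      | nil => rfl
      | cons a u ih =>
        simp only [splitSum]
        rw [ih fun u₁ u₂ => K (a :: u₁) u₂, ← splitSum_add]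
    exact swap (fun u₁ u₂ v x => G (u₁.map σ) (u₂.map σ ++ b v :: x)) u y
  rw [h1, h2, ← splitSum_add]
  refine splitSum_congr fun u y _ => ?_
  rw [← splitSum_add]
  refine splitSum_congr fun v x _ => ?_
  rw [splitSum_append_cons, splitSum_map, add_comm]

end Words

/-- A function on words which is linear in each letter. -/
def IsWordLinear (k : Type u) {A : Type v} {X : Type w} [Field k] [AddCommGroup A] [Module k A]
    [AddCommGroup X] [Module k X] (G : List A → X) : Prop :=
  ∀ u x, IsLinearMap k fun c => G (u ++ c :: x)

/-- The function on words which is the identity on words of length one and zero on all others. -/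
def letter {A : Type v} [AddCommGroup A] : List A → A
  | [a] => a
  | _ => 0

section Letter

variable {A : Type v} [AddCommGroup A]

theorem letter_append_cons {u x : List A} (h : u ≠ [] ∨ x ≠ []) (c : A) :
    letter (u ++ c :: x) = 0 := by
  rcases u with _ | ⟨a, _ | ⟨a', u⟩⟩
  · rcases x with _ | ⟨a, x⟩
    · simp at h
    · rfl
  · rfl
  · rfl

theorem insertSum_letter (σ : A → A) (b : List A → A) (w : List A) :
    insertSum σ b letter w = b w := by
  rw [insertSum, splitSum_eq_right, splitSum_eq_left]
  · rfl
  · intro u a v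
    exact letter_append_cons (Or.inr (List.cons_ne_nil a v)) _
  · intro a u v
    rw [← splitSum_zero v]
    exact splitSum_congr fun v x _ => letter_append_cons (Or.inl (by simp)) _

theorem isWordLinear_letter (k : Type u) [Field k] [Module k A] :
    IsWordLinear k (letter : List A → A) := by
  intro u x
  by_cases h : u ≠ [] ∨ x ≠ []
  · simp only [letter_append_cons h]
    exact (0 : A →ₗ[k] A).isLinear
  · push Not at h
    obtain ⟨rfl, rfl⟩ := h
    exact (LinearMap.id : A →ₗ[k] A).isLinear

end Letter

theorem IsLinearMap.splitSum {k : Type u} {A : Type v} {X Y : Type*} [Field k]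
    [AddCommGroup X] [Module k X] [AddCommGroup Y] [Module k Y]
    {G : Y → List A → List A → X} (hG : ∀ u v, IsLinearMap k fun c => G c u v) (w : List A) :
    IsLinearMap k fun c => splitSum (G c) w where
  map_add c c' := by
    rw [← splitSum_add]
    exact splitSum_congr fun u v _ => (hG u v).map_add c c'
  map_smul r c := by
    change _ = LinearMap.lsmul k X r (_root_.splitSum (G c) w)
    rw [map_splitSum]
    exact splitSum_congr fun u v _ => (hG u v).map_smul r c

/-! ### The recursion for the transferred structure -/

/-- The data on a dg-algebra used to transfer its structure: the sign operator `τ = (-1)^deg`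
and a homotopy `H` of degree `-1`. -/
structure TransferData (k : Type u) (A : Type v) [Field k] [AddCommGroup A] [Module k A] where
  d : A →ₗ[k] A
  mul : A →ₗ[k] A →ₗ[k] A
  τ : A →ₗ[k] A
  H : A →ₗ[k] A
  d_d : ∀ x, d (d x) = 0
  mul_assoc : ∀ x y z, mul (mul x y) z = mul x (mul y z)
  d_mul : ∀ x y, d (mul x y) = mul (d x) y + mul (τ x) (d y)
  τ_τ : ∀ x, τ (τ x) = x
  τ_d : ∀ x, τ (d x) = -d (τ x)
  τ_H : ∀ x, τ (H x) = -H (τ x)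
  τ_mul : ∀ x y, τ (mul x y) = mul (τ x) (τ y)

namespace TransferData

variable {k : Type u} {A : Type v} [Field k] [AddCommGroup A] [Module k A]
  (T : TransferData k A)

/-- The Koszul sign of the suspended grading. -/
def σ : A →ₗ[k] A := -T.τ

/-- The product `∑ (-1)^{|f u|} (f u) (f v)` over the ways to cut a word in two. -/
def cup (f : List A → A) : List A → A := splitSum fun u v => T.mul (T.τ (f u)) (f v)

/-- The approximations to the transferred morphism; the `n`-th one is correct on words of
length at most `n`. -/
def approx : ℕ → List A → A
  | 0, _ => 0
  | n + 1, w => letter w - T.H (T.cup (approx n) w)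

/-- The transferred morphism: the solution of `f = letter - H (f ∪ f)`. -/
def f (w : List A) : A := T.approx w.length w

/-- The projection `1 - d H - H d`. -/
def proj : A →ₗ[k] A := LinearMap.id - T.d ∘ₗ T.H - T.H ∘ₗ T.d

/-- The transferred operations. -/
def b (w : List A) : A := T.d (letter w) + T.proj (T.cup T.f w)

theorem cup_nil {f : List A → A} (hf : f [] = 0) : T.cup f [] = 0 := by
  simp [cup, splitSum, hf]

theorem cup_singleton {f : List A → A} (hf : f [] = 0) (a : A) : T.cup f [a] = 0 := by
  simp [cup, splitSum, hf]

theorem approx_nil (n : ℕ) : T.approx n [] = 0 := by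
  induction n with
  | zero => rfl
  | succ n ih => simp [approx, T.cup_nil ih, letter]

theorem f_nil : T.f [] = 0 := T.approx_nil 0

/-- As `f` vanishes on the empty word, `f ∪ f` only involves strictly shorter words. -/
theorem cup_congr {f g : List A → A} (hf : f [] = 0) (hg : g [] = 0) {w : List A}
    (h : ∀ u, u.length < w.length → f u = g u) : T.cup f w = T.cup g w := by
  refine splitSum_congr fun u v huv => ?_
  have hlen := congrArg List.length huv
  rw [List.length_append] at hlen
  rcases u with _ | ⟨a, u⟩
  · simp [hf, hg]
  rcases v with _ | ⟨a', v⟩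
  · simp [hf, hg]
  rw [List.length_cons, List.length_cons] at hlen
  rw [h _ (by rw [List.length_cons]; omega), h _ (by rw [List.length_cons]; omega)]

theorem approx_eq_approx {n m : ℕ} {w : List A} (hn : w.length ≤ n) (hm : w.length ≤ m) :
    T.approx n w = T.approx m w := by
  induction n generalizing m w with
  | zero =>
    obtain rfl := List.length_eq_zero_iff.mp (Nat.le_zero.mp hn)
    rw [approx_nil, approx_nil]
  | succ n ih =>
    rcases m with _ | m
    · obtain rfl := List.length_eq_zero_iff.mp (Nat.le_zero.mp hm)
      rw [approx_nil, approx_nil]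
    · rw [approx, approx, T.cup_congr (T.approx_nil n) (T.approx_nil m) fun u hu =>
        ih (by omega) (by omega)]

theorem approx_eq (n : ℕ) (w : List A) (hw : w.length ≤ n) : T.approx n w = T.f w :=
  T.approx_eq_approx hw le_rfl

theorem f_eq (w : List A) : T.f w = letter w - T.H (T.cup T.f w) := by
  rw [← T.approx_eq (w.length + 1) w (by omega), approx,
    T.cup_congr (T.approx_nil _) T.f_nil fun u hu => T.approx_eq _ u hu.le]

theorem f_singleton (a : A) : T.f [a] = a := by
  rw [f_eq, T.cup_singleton T.f_nil, map_zero, sub_zero]; rfl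

theorem b_nil : T.b [] = 0 := by simp [b, T.cup_nil T.f_nil, letter]

theorem b_singleton (a : A) : T.b [a] = T.d a := by
  rw [b, T.cup_singleton T.f_nil, map_zero, add_zero]; rfl

/-- The components of `f` have degree one for the suspended grading. -/
theorem f_map_σ (w : List A) : T.f (w.map T.σ) = -T.τ (T.f w) := by
  have key : ∀ (n : ℕ) (w : List A), T.approx n (w.map T.σ) = -T.τ (T.approx n w) := by
    intro n
    induction n with
    | zero => intro w; simp [approx]
    | succ n ih =>
      intro w
      have hl : letter (w.map T.σ) = -T.τ (letter w) := by
        rcases w with _ | ⟨a, _ | ⟨a', w⟩⟩ <;> simp [letter, σ]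
      have hc : T.cup (T.approx n) (w.map T.σ) = T.τ (T.cup (T.approx n) w) := by
        rw [cup, splitSum_map, map_splitSum]
        refine splitSum_congr fun u v _ => ?_
        rw [ih, ih, T.τ_mul]; simp
      rw [approx, approx, hl, hc, map_sub, T.τ_H]; abel
  rw [f, List.length_map, key, f]

/-- The differential of `f ∪ f` in terms of the failure `R` of `f` to be an `A∞`-morphism. -/
theorem d_cup_add_insertSum (w : List A) :
    T.d (T.cup T.f w) + insertSum T.σ T.b (T.cup T.f) w =
      splitSum (fun u v =>
        T.mul (T.f u) (T.d (T.f v) - insertSum T.σ T.b T.f v + T.cup T.f v) -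
        T.mul (T.τ (T.d (T.f u) - insertSum T.σ T.b T.f u + T.cup T.f u)) (T.f v)) w := by
  have h1 : ∀ u v, insertSum T.σ T.b (fun z => T.mul (T.τ (T.f z)) (T.f v)) u =
      T.mul (T.τ (insertSum T.σ T.b T.f u)) (T.f v) := fun u v =>
    (map_insertSum T.σ T.b ((LinearMap.flip T.mul (T.f v)) ∘ₗ T.τ) T.f u).symm
  have h2 : ∀ u v, insertSum T.σ T.b (fun z => T.mul (T.τ (T.f (u.map T.σ))) (T.f z)) v =
      - T.mul (T.f u) (insertSum T.σ T.b T.f v) := by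
    intro u v
    rw [f_map_σ, map_neg, T.τ_τ, ← map_insertSum T.σ T.b (T.mul (-T.f u)), map_neg,
      LinearMap.neg_apply]
  have h3 : splitSum (fun u v => T.mul (T.τ (T.cup T.f u)) (T.f v)) w =
      splitSum (fun u v => T.mul (T.f u) (T.cup T.f v)) w := by
    have e1 : ∀ u v, T.mul (T.τ (T.cup T.f u)) (T.f v) = splitSum (fun u₁ u₂ =>
        T.mul (T.f u₁) (T.mul (T.τ (T.f u₂)) (T.f v))) u := by
      intro u v
      have := map_splitSum ((LinearMap.flip T.mul (T.f v)) ∘ₗ T.τ)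
        (fun u v => T.mul (T.τ (T.f u)) (T.f v)) u
      refine this.trans (splitSum_congr fun u₁ u₂ _ => ?_)
      simp [T.τ_mul, T.τ_τ, T.mul_assoc]
    have e2 : ∀ u v, T.mul (T.f u) (T.cup T.f v) = splitSum (fun v₁ v₂ =>
        T.mul (T.f u) (T.mul (T.τ (T.f v₁)) (T.f v₂))) v := fun u v =>
      map_splitSum (T.mul (T.f u)) _ v
    simp only [e1, e2]
    exact splitSum_assoc (fun u v y => T.mul (T.f u) (T.mul (T.τ (T.f v)) (T.f y))) w
  have h4 : T.d (T.cup T.f w) = splitSum (fun u v =>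
      T.mul (T.f u) (T.d (T.f v)) - T.mul (T.τ (T.d (T.f u))) (T.f v)) w := by
    rw [cup, map_splitSum]
    refine splitSum_congr fun u v _ => ?_
    rw [T.d_mul, T.τ_τ, T.τ_d, map_neg, LinearMap.neg_apply]; abel
  have h5 : insertSum T.σ T.b (T.cup T.f) w = splitSum (fun u v =>
      T.mul (T.τ (insertSum T.σ T.b T.f u)) (T.f v) -
        T.mul (T.f u) (insertSum T.σ T.b T.f v)) w := by
    rw [cup, insertSum_splitSum]
    simp only [h1, h2]
    rw [splitSum_neg, splitSum_sub]; abel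
  have h6 : ∀ u v, T.mul (T.f u) (T.d (T.f v) - insertSum T.σ T.b T.f v + T.cup T.f v) -
        T.mul (T.τ (T.d (T.f u) - insertSum T.σ T.b T.f u + T.cup T.f u)) (T.f v) =
      (T.mul (T.f u) (T.d (T.f v)) - T.mul (T.τ (T.d (T.f u))) (T.f v)) +
      (T.mul (T.τ (insertSum T.σ T.b T.f u)) (T.f v) -
        T.mul (T.f u) (insertSum T.σ T.b T.f v)) +
      (T.mul (T.f u) (T.cup T.f v) - T.mul (T.τ (T.cup T.f u)) (T.f v)) := by
    intro u v
    simp only [map_add, map_sub, LinearMap.add_apply, LinearMap.sub_apply]; abel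
  -- `R = d f - f ∘ b̂ + f ∪ f` is added up from the three contributions; that of `f ∪ f` is zero by
  -- associativity.
  simp only [h6]
  rw [splitSum_add, splitSum_add, ← h4, ← h5, splitSum_sub _ _ w, h3, sub_self, add_zero]

/-- The failure of `f` to be a morphism is `H` applied to the failure of `f ∪ f` to be closed. -/
theorem d_f_sub_insertSum_add_cup (w : List A) :
    T.d (T.f w) - insertSum T.σ T.b T.f w + T.cup T.f w =
      T.H (T.d (T.cup T.f w) + insertSum T.σ T.b (T.cup T.f) w) := by
  have hi : insertSum T.σ T.b T.f w =
      T.b w - T.H (insertSum T.σ T.b (T.cup T.f) w) := by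
    rw [map_insertSum, ← insertSum_letter T.σ T.b w, ← insertSum_sub]
    exact congrArg (fun g => insertSum T.σ T.b g w) (funext T.f_eq)
  rw [hi, f_eq, b, proj]
  simp only [map_sub, map_add, LinearMap.sub_apply, LinearMap.comp_apply, LinearMap.id_apply]
  abel

/-- The morphism equation for `f`. -/
theorem f_isMorphism (w : List A) :
    T.d (T.f w) - insertSum T.σ T.b T.f w + T.cup T.f w = 0 := by
  induction hn : w.length using Nat.strong_induction_on generalizing w with
  | _ n ih =>
    subst hn
    rw [d_f_sub_insertSum_add_cup, d_cup_add_insertSum, ← map_zero T.H]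
    congr 1
    rw [← splitSum_zero w]
    refine splitSum_congr fun u v huv => ?_
    have hlen := congrArg List.length huv
    rw [List.length_append] at hlen
    have h1 : T.mul (T.f u) (T.d (T.f v) - insertSum T.σ T.b T.f v + T.cup T.f v) = 0 := by
      rcases u with _ | ⟨a, u⟩
      · rw [f_nil, map_zero, LinearMap.zero_apply]
      · rw [ih _ (by rw [← hlen, List.length_cons]; omega) v rfl, map_zero]
    have h2 : T.mul (T.τ (T.d (T.f u) - insertSum T.σ T.b T.f u + T.cup T.f u)) (T.f v) = 0 := by
      rcases v with _ | ⟨a, v⟩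
      · rw [f_nil, map_zero]
      · rw [ih _ (by rw [← hlen, List.length_cons]; omega) u rfl, map_zero, map_zero,
          LinearMap.zero_apply]
    rw [h1, h2, sub_zero]

theorem d_cup_add_insertSum_eq_zero (w : List A) :
    T.d (T.cup T.f w) + insertSum T.σ T.b (T.cup T.f) w = 0 := by
  rw [d_cup_add_insertSum]
  simp only [f_isMorphism, map_zero, LinearMap.zero_apply, sub_zero, splitSum_zero]

theorem proj_d (x : A) : T.proj (T.d x) = T.d (T.proj x) := by
  simp [proj, T.d_d]

/-- The `A∞`-relations for the transferred operations. -/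
theorem insertSum_b (w : List A) : insertSum T.σ T.b T.b w = 0 := by
  have h : insertSum T.σ T.b T.b w = insertSum T.σ T.b (fun u => T.d (letter u)) w +
      insertSum T.σ T.b (fun u => T.proj (T.cup T.f u)) w := insertSum_add _ _ _ _ w
  rw [h, ← map_insertSum, ← map_insertSum, insertSum_letter, b, map_add, T.d_d, zero_add,
    ← T.proj_d, ← map_add, d_cup_add_insertSum_eq_zero, map_zero]

theorem isWordLinear_cup {f : List A → A} (hf : IsWordLinear k f) : IsWordLinear k (T.cup f) := by
  intro u x
  simp only [cup, splitSum_append_cons]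
  have h1 := IsLinearMap.splitSum (k := k)
    (G := fun c u₁ u₂ => T.mul (T.τ (f u₁)) (f (u₂ ++ c :: x))) (fun u₁ u₂ =>
      (T.mul (T.τ (f u₁)) ∘ₗ (hf u₂ x).mk').isLinear) u
  have h2 := IsLinearMap.splitSum (k := k)
    (G := fun c x₁ x₂ => T.mul (T.τ (f (u ++ c :: x₁))) (f x₂)) (fun x₁ x₂ =>
      (T.mul.flip (f x₂) ∘ₗ T.τ ∘ₗ (hf u x₁).mk').isLinear) x
  exact (h1.mk' + h2.mk').isLinear

theorem isWordLinear_f : IsWordLinear k T.f := by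
  have key : ∀ n, IsWordLinear k (T.approx n) := by
    intro n
    induction n with
    | zero => exact fun u x => (0 : A →ₗ[k] A).isLinear
    | succ n ih => exact fun u x =>
        ((isWordLinear_letter k u x).mk' - T.H ∘ₗ (T.isWordLinear_cup ih u x).mk').isLinear
  intro u x
  have : ∀ c, T.f (u ++ c :: x) = T.approx (u.length + x.length + 1) (u ++ c :: x) := fun c => by
    rw [T.approx_eq _ _ (by simp; omega)]
  simp only [this]
  exact key _ u x

theorem isWordLinear_b : IsWordLinear k T.b := fun u x =>
  (T.d ∘ₗ (isWordLinear_letter k u x).mk' +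
    T.proj ∘ₗ (T.isWordLinear_cup T.isWordLinear_f u x).mk').isLinear

end TransferData

/-! ### From words to multilinear operations -/

section Sequences

variable {A : Type v} {X : Type w} [AddCommGroup X]

/-- The word `a₀ a₁ … a_{n-1}`. -/
def word (n : ℕ) (a : ℕ → A) : List A := List.ofFn fun i : Fin n => a i

theorem word_add (m n : ℕ) (a : ℕ → A) :
    word (m + n) a = word m a ++ word n fun j => a (m + j) := by
  rw [word, List.ofFn_add]; rfl

theorem word_succ (n : ℕ) (a : ℕ → A) : word (n + 1) a = a 0 :: word n fun j => a (j + 1) := by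
  rw [word, List.ofFn_succ]; rfl

theorem word_replaceBlock (a : ℕ → A) (r s t : ℕ) (y : A) :
    word (r + 1 + t) (replaceBlock a r s y) = word r a ++ y :: word t fun j => a (r + s + j) := by
  rw [word_add, word_add, List.append_assoc]
  congr 1
  · simp only [word]
    congr 1
    funext i
    simp [replaceBlock]
  · rw [word_succ]
    simp only [word, List.ofFn_zero, List.cons_append, List.nil_append]
    congr 1
    · simp [replaceBlock]
    · congr 1
      funext i
      simp only [replaceBlock]
      rw [if_neg (by omega), if_neg (by omega)]
      congr 1
      omega

theorem splitSum_word (G : List A → List A → X) (n : ℕ) (a : ℕ → A) :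
    splitSum G (word n a) =
      ∑ x ∈ antidiagonal n, G (word x.1 a) (word x.2 fun j => a (x.1 + j)) := by
  induction n generalizing a G with
  | zero => simp [word, splitSum]
  | succ n ih =>
    rw [word_succ, splitSum, ih, Finset.Nat.sum_antidiagonal_succ]
    congr 1
    · simp only [word, zero_add, List.ofFn_zero, List.ofFn_succ]; rfl
    · refine Finset.sum_congr rfl fun x _ => ?_
      rw [word_succ]
      congr 2
      funext j
      congr 1
      omega

theorem insertSum_word (σ : A → A) (b : List A → A) (G : List A → X) (n : ℕ) (a : ℕ → A) :
    insertSum σ b G (word n a) = ∑ x ∈ antidiagonal n, ∑ y ∈ antidiagonal x.2,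
      G ((word x.1 a).map σ ++ b (word y.1 fun j => a (x.1 + j)) ::
        word y.2 fun j => a (x.1 + y.1 + j)) := by
  rw [insertSum, splitSum_word]
  refine Finset.sum_congr rfl fun x _ => ?_
  rw [splitSum_word]
  simp only [add_assoc]

/-- A sum over compositions whose terms vanish unless there are one or two blocks. -/
theorem sum_composition_eq (n : ℕ) (t : List ℕ → X) (h0 : t [] = 0)
    (h1 : t [0] = 0) (hl : ∀ j, t [0, j] = 0) (hr : ∀ i, t [i, 0] = 0)
    (h3 : ∀ i j l w, t (i :: j :: l :: w) = 0) :
    ∑ c : Composition n, t c.blocks = t [n] + ∑ x ∈ antidiagonal n, t [x.1, x.2] := by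
  classical
  have e1 : ∑ c : Composition n, t c.blocks =
      ∑ l ∈ (univ : Finset (Composition n)).image (fun c => c.blocks), t l :=
    (Finset.sum_image fun c _ c' _ h => Composition.ext h).symm
  have e2 : t [n] + ∑ x ∈ antidiagonal n, t [x.1, x.2] =
      ∑ l ∈ insert [n] ((antidiagonal n).image fun x => [x.1, x.2]), t l := by
    rw [Finset.sum_insert (by simp), Finset.sum_image]
    rintro ⟨i, j⟩ _ ⟨i', j'⟩ _ h
    simpa using h
  rw [e1, e2]
  refine Finset.sum_congr_of_eq_on_inter ?_ ?_ fun _ _ _ => rfl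
  · intro l hl' hlS
    obtain ⟨c, -, rfl⟩ := Finset.mem_image.mp hl'
    have hs := c.blocks_sum
    rcases hb : c.blocks with _ | ⟨i, _ | ⟨j, _ | ⟨l, w⟩⟩⟩
    · exact h0
    · rw [hb] at hlS hs
      simp at hs
      simp [hs] at hlS
    · rw [hb] at hlS hs
      simp at hs
      simp [hs] at hlS
    · exact h3 _ _ _ _
  · intro l hlS hl'
    rcases Finset.mem_insert.mp hlS with rfl | hlS
    · rcases Nat.eq_zero_or_pos n with rfl | hn
      · exact h1
      · exact absurd (Finset.mem_image.mpr ⟨Composition.single n hn, mem_univ _, rfl⟩) hl'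
    · obtain ⟨⟨i, j⟩, hij, rfl⟩ := Finset.mem_image.mp hlS
      rw [HasAntidiagonal.mem_antidiagonal] at hij
      rcases Nat.eq_zero_or_pos i with rfl | hi
      · exact hl _
      rcases Nat.eq_zero_or_pos j with rfl | hj
      · exact hr _
      have hpos : ∀ {m}, m ∈ [i, j] → 0 < m := by
        intro m hm
        simp at hm
        omega
      let c : Composition n := ⟨[i, j], hpos, by simpa using hij⟩
      exact absurd (Finset.mem_image.mpr ⟨c, mem_univ _, rfl⟩) hl'

end Sequences

theorem ofFn_update {A : Type v} {n : ℕ} (a : Fin n → A) (i : Fin n) (c : A) :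
    List.ofFn (Function.update a i c) =
      (List.ofFn a).take i ++ c :: (List.ofFn a).drop (i + 1) := by
  rw [← List.set_eq_take_cons_drop c (by simp)]
  refine List.ext_getElem (by simp) fun j _ _ => ?_
  simp [Function.update_apply, List.getElem_set, Fin.ext_iff, eq_comm]

namespace IsWordLinear

variable {k : Type u} {A : Type v} {X : Type w} [Field k] [AddCommGroup A] [Module k A]
  [AddCommGroup X] [Module k X] {G : List A → X}

theorem map_negOnePow_smul (hG : IsWordLinear k G) (u x : List A) (m : ℤ) (c : A) :
    G (u ++ m.negOnePow • c :: x) = m.negOnePow • G (u ++ c :: x) := by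
  rw [Units.smul_def, Units.smul_def]
  exact map_zsmul (hG u x).mk' _ c

theorem map_word_negOnePow_smul (hG : IsWordLinear k G) (n : ℕ) (a : ℕ → A) (m : ℕ → ℤ)
    (x : List A) :
    G (word n (fun i => (m i).negOnePow • a i) ++ x) =
      (∑ i ∈ range n, m i).negOnePow • G (word n a ++ x) := by
  induction n generalizing x with
  | zero => simp [word]
  | succ n ih =>
    have hw : ∀ a : ℕ → A, word (n + 1) a ++ x = word n a ++ a n :: x := fun a => by
      rw [word_add, List.append_assoc]; simp [word]
    rw [hw, hw, hG.map_negOnePow_smul, ih, Finset.sum_range_succ, smul_smul,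
      ← Int.negOnePow_add, add_comm]

/-- The multilinear map given by a function on words which is linear in each letter. -/
def toMultilinear (hG : IsWordLinear k G) (s : ℕ) : MultilinearMap k (fun _ : Fin s => A) X where
  toFun a := G (List.ofFn a)
  map_update_add' a i x y := by
    rename_i inst
    obtain rfl : inst = instDecidableEqFin s := Subsingleton.elim _ _
    simp only [ofFn_update]
    exact (hG _ _).map_add x y
  map_update_smul' a i r x := by
    rename_i inst
    obtain rfl : inst = instDecidableEqFin s := Subsingleton.elim _ _
    simp only [ofFn_update]
    exact (hG _ _).map_smul r x

/-- The multilinear map `(a₀, …, a_{s-1}) ↦ G (τ^{s-1} a₀, …, τ a_{s-2}, a_{s-1})`. With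
`τ = (-1)^deg` this passes from the suspended sign conventions to the unsuspended ones. -/
def desuspend (hG : IsWordLinear k G) (τ : A →ₗ[k] A) (s : ℕ) :
    MultilinearMap k (fun _ : Fin s => A) X :=
  (hG.toMultilinear s).compLinearMap fun i => τ ^ (s - 1 - (i : ℕ))

theorem desuspend_apply (hG : IsWordLinear k G) (τ : A →ₗ[k] A) (s : ℕ) (a : Fin s → A) :
    hG.desuspend τ s a = G (List.ofFn fun i => (τ ^ (s - 1 - (i : ℕ))) (a i)) := rfl

end IsWordLinear

/-- `τ` acts by the sign `(-1)ⁿ` in degree `n`. -/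
def GradedSpace.IsSign {k : Type u} {A : Type v} [Field k] [AddCommGroup A] [Module k A]
    (S : GradedSpace k A) (τ : A →ₗ[k] A) : Prop :=
  ∀ n, ∀ x ∈ S.gr n, τ x = n.negOnePow • x

namespace GradedSpace.IsSign

variable {k : Type u} {A : Type v} {X : Type w} [Field k] [AddCommGroup A] [Module k A]
  [AddCommGroup X] [Module k X] {S : GradedSpace k A} {τ : A →ₗ[k] A}

theorem mem (hτ : S.IsSign τ) {P : Submodule k A} {n : ℤ} (hP : P ≤ S.gr n) {x : A}
    (hx : x ∈ P) : τ x ∈ P := by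
  rw [hτ n x (hP hx), Units.smul_def]
  exact zsmul_mem hx _

theorem pow_mem (hτ : S.IsSign τ) {P : Submodule k A} {n : ℤ} (hP : P ≤ S.gr n) (j : ℕ) {x : A}
    (hx : x ∈ P) : (τ ^ j) x ∈ P := by
  induction j with
  | zero => exact hx
  | succ j ih => rw [pow_succ', Module.End.mul_apply]; exact hτ.mem hP ih

theorem pow_apply (hτ : S.IsSign τ) {n : ℤ} (j : ℕ) {x : A} (hx : x ∈ S.gr n) :
    (τ ^ j) x = (j * n).negOnePow • x := by
  induction j with
  | zero => simp
  | succ j ih =>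
    rw [pow_succ', Module.End.mul_apply, hτ n _ (hτ.pow_mem le_rfl j hx), ih, smul_smul,
      ← Int.negOnePow_add]
    congr 2
    push_cast
    ring

/-- On homogeneous elements, desuspension multiplies by the sign `(-1)^{∑ (s-1-i) |aᵢ|}`. -/
theorem desuspend_apply (hτ : S.IsSign τ) {G : List A → X} (hG : IsWordLinear k G) (s : ℕ)
    {a : ℕ → A} {deg : ℕ → ℤ} (ha : ∀ i, a i ∈ S.gr (deg i)) :
    hG.desuspend τ s (fun i => a i) =
      (∑ i ∈ range s, ((s : ℤ) - 1 - i) * deg i).negOnePow • G (word s a) := by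
  have h := hG.map_word_negOnePow_smul s a (fun i => ((s : ℤ) - 1 - i) * deg i) []
  rw [List.append_nil, List.append_nil] at h
  rw [← h, IsWordLinear.desuspend_apply, word]
  congr 2
  funext i
  rw [hτ.pow_apply _ (ha i)]
  congr 2
  have := i.2
  rw [Nat.cast_sub (by omega), Nat.cast_sub (by omega)]
  simp

variable {b : List A → A} (hb : IsWordLinear k b)

/-- The term `f (1 ⊗ m ⊗ 1)` of the `A∞`-relations in suspended form. -/
theorem innerTerm_desuspend (hτ : S.IsSign τ) {G : List A → X} (hG : IsWordLinear k G)
    (hdeg : ∀ (s : ℕ) (x : Fin s → A) (n : Fin s → ℤ), (∀ i, x i ∈ S.gr (n i)) →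
      hb.desuspend τ s x ∈ S.gr (∑ i, n i + 2 - s))
    {a : ℕ → A} {deg : ℕ → ℤ} (ha : ∀ i, a i ∈ S.gr (deg i)) (r s t : ℕ) :
    innerTerm (hb.desuspend τ) (hG.desuspend τ) a deg r s t =
      (∑ i ∈ range (r + (s + t)), ((r : ℤ) + (s + t) - 1 - i) * deg i).negOnePow •
        G ((word r a).map (-τ) ++ b (word s fun j => a (r + j)) ::
          word t fun j => a (r + s + j)) := by
  set y := hb.desuspend τ s (fun j => a (r + j)) with hy
  have hyd : y ∈ S.gr (∑ j ∈ range s, deg (r + j) + 2 - s) := by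
    rw [Finset.sum_range]
    exact hdeg s _ _ fun i => ha _
  set dy := ∑ j ∈ range s, deg (r + j) + 2 - s with hdy
  have hrep : ∀ i, replaceBlock a r s y i ∈ S.gr (replaceBlock deg r s dy i) := by
    intro i
    simp only [replaceBlock]
    split_ifs
    · exact ha i
    · exact hyd
    · exact ha _
  have hσ : (word r a).map (-τ) = word r fun i => (deg i + 1).negOnePow • a i := by
    simp only [word, List.map_ofFn]
    congr 1
    funext i
    simp [hτ _ _ (ha i), Int.negOnePow_succ]
  rw [innerTerm, hτ.desuspend_apply hG _ hrep, word_replaceBlock, hy,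
    hτ.desuspend_apply hb s fun j => ha (r + j), hG.map_negOnePow_smul, hσ,
    hG.map_word_negOnePow_smul, smul_smul, smul_smul, smul_smul, ← Int.negOnePow_add,
    ← Int.negOnePow_add, ← Int.negOnePow_add]
  congr 1
  rw [Int.negOnePow_eq_iff]
  have hlin : ∀ (m : ℕ) (c : ℤ) (e : ℕ → ℤ), ∑ i ∈ range m, (c - i) * e i =
      c * ∑ i ∈ range m, e i - ∑ i ∈ range m, i * e i := by
    intro m c e
    rw [Finset.mul_sum, ← Finset.sum_sub_distrib]
    exact Finset.sum_congr rfl fun i _ => by ring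
  have h1 : ∑ i ∈ range (r + 1 + t), (((r + 1 + t : ℕ) : ℤ) - 1 - i) * replaceBlock deg r s dy i =
      ∑ i ∈ range r, ((r : ℤ) + t - i) * deg i + t * dy +
        ∑ j ∈ range t, ((t : ℤ) - 1 - j) * deg (r + s + j) := by
    rw [Finset.sum_range_add, Finset.sum_range_succ]
    congr 1
    · congr 1
      · refine Finset.sum_congr rfl fun i hi => ?_
        simp only [replaceBlock, if_pos (Finset.mem_range.mp hi)]
        push_cast; ring
      · simp [replaceBlock]; ring_nf; simp
    · refine Finset.sum_congr rfl fun j _ => ?_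
      simp only [replaceBlock]
      rw [if_neg (by omega), if_neg (by omega), show r + 1 + j - 1 + s = r + s + j by omega]
      push_cast; ring
  have h2 : ∑ i ∈ range (r + (s + t)), ((r : ℤ) + (s + t) - 1 - i) * deg i =
      ∑ i ∈ range r, ((r : ℤ) + (s + t) - 1 - i) * deg i +
        (∑ j ∈ range s, ((s : ℤ) + t - 1 - j) * deg (r + j) +
        ∑ j ∈ range t, ((t : ℤ) - 1 - j) * deg (r + s + j)) := by
    rw [Finset.sum_range_add, Finset.sum_range_add]
    congr 2
    · refine Finset.sum_congr rfl fun i _ => ?_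
      push_cast; ring
    · refine Finset.sum_congr rfl fun i _ => ?_
      rw [add_assoc r s i]
      push_cast; ring
  have e1 := hlin r ((r : ℤ) + t) deg
  have e2 := hlin r ((r : ℤ) + (s + t) - 1) deg
  have e3 := hlin s ((s : ℤ) - 1) fun j => deg (r + j)
  have e4 := hlin s ((s : ℤ) + t - 1) fun j => deg (r + j)
  beta_reduce at e3 e4
  have e5 : ∑ i ∈ range r, (deg i + 1) = ∑ i ∈ range r, deg i + r := by
    rw [Finset.sum_add_distrib]; simp
  -- The two exponents differ by `2t`, from the summand `2` in the degree `2 - s` of `m`.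
  exact ⟨t, by rw [h1, h2, e1, e2, e3, e4, e5, hdy]; ring⟩

/-- The left-hand side of the `A∞`-relations in suspended form. -/
theorem innerSum_desuspend (hτ : S.IsSign τ) {G : List A → X} (hG : IsWordLinear k G)
    (hdeg : ∀ (s : ℕ) (x : Fin s → A) (n : Fin s → ℤ), (∀ i, x i ∈ S.gr (n i)) →
      hb.desuspend τ s x ∈ S.gr (∑ i, n i + 2 - s))
    {a : ℕ → A} {deg : ℕ → ℤ} (ha : ∀ i, a i ∈ S.gr (deg i)) (n : ℕ) :
    innerSum (hb.desuspend τ) (hG.desuspend τ) n a deg =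
      (∑ i ∈ range n, ((n : ℤ) - 1 - i) * deg i).negOnePow •
        insertSum (-τ) b G (word n a) := by
  rw [insertSum_word, innerSum, Finset.smul_sum]
  refine Finset.sum_congr rfl fun x hx => ?_
  rw [Finset.smul_sum]
  refine Finset.sum_congr rfl fun y hy => ?_
  rw [HasAntidiagonal.mem_antidiagonal] at hx hy
  rw [innerTerm_desuspend hb hτ hG hdeg ha, ← hx, ← hy]
  push_cast
  rfl

end GradedSpace.IsSign

/-- The right-hand side of the morphism equation in suspended form. Only compositions with one or
two blocks contribute, as the target is a dg-algebra. -/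
theorem FilteredDGAlgebra.outerSum_desuspend {k : Type u} {A : Type v} [Field k]
    [AddCommGroup A] [Module k A] (𝒜 : FilteredDGAlgebra k A) {τ : A →ₗ[k] A}
    (hτ : 𝒜.IsSign τ) {G : List A → A} (hG : IsWordLinear k G) (hG0 : G [] = 0)
    (hdeg : ∀ (s : ℕ) (a : ℕ → A) (deg : ℕ → ℤ), (∀ i, a i ∈ 𝒜.gr (deg i)) →
      G (word s a) ∈ 𝒜.gr (∑ i ∈ range s, deg i + 1 - s))
    {a : ℕ → A} {deg : ℕ → ℤ} (ha : ∀ i, a i ∈ 𝒜.gr (deg i)) (n : ℕ) :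
    outerSum 𝒜.ops (hG.desuspend τ) n a deg =
      (∑ i ∈ range n, ((n : ℤ) - 1 - i) * deg i).negOnePow •
        (𝒜.d (G (word n a)) + splitSum (fun u v => 𝒜.mul (τ (G u)) (G v)) (word n a)) := by
  let t : List ℕ → A
    | [i] => 𝒜.d (G (word i a))
    | [i, j] => 𝒜.mul (τ (G (word i a))) (G (word j fun l => a (i + l)))
    | _ => 0
  have hw0 : ∀ a : ℕ → A, G (word 0 a) = 0 := fun a => by rw [← hG0]; rfl
  have hsum := sum_composition_eq n t rfl (by simp [t, hw0]) (by simp [t, hw0])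
    (by simp [t, hw0]) (fun _ _ _ _ => rfl)
  rw [splitSum_word]
  change _ = _ • (t [n] + ∑ x ∈ antidiagonal n, t [x.1, x.2])
  rw [← hsum, outerSum, Finset.smul_sum]
  refine Finset.sum_congr rfl fun c _ => ?_
  obtain ⟨blocks, hpos, hs⟩ := c
  rcases blocks with _ | ⟨i, _ | ⟨j, _ | ⟨l, w⟩⟩⟩
  · change _ • (0 : A) = _ • (0 : A)
    rw [smul_zero, smul_zero]
  · obtain rfl : i = n := by simpa using hs
    change (∑ l : Fin 1, _ : ℤ).negOnePow • 𝒜.ops 1 (fun l : Fin 1 => _) = _ • 𝒜.d _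
    rw [𝒜.ops_one, Fin.sum_univ_one]
    change Int.negOnePow ((((1 : ℕ) : ℤ) - 1 - ((0 : ℕ) : ℤ)) * ((i : ℤ) - 1) +
      (1 - (i : ℤ)) * ∑ j ∈ range 0, deg j) •
      𝒜.d (hG.desuspend τ i fun j => a (0 + j)) = _
    simp only [zero_add]
    rw [hτ.desuspend_apply hG i ha, Units.smul_def (Int.negOnePow (∑ i ∈ range _, _)), map_zsmul]
    simp [Units.smul_def]
  · obtain rfl : i + j = n := by simpa using hs
    change (∑ l : Fin 2, _ : ℤ).negOnePow • 𝒜.ops 2 (fun l : Fin 2 => _) = _ • 𝒜.mul _ _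
    rw [𝒜.ops_two, Fin.sum_univ_two]
    change Int.negOnePow (((((2 : ℕ) : ℤ) - 1 - ((0 : ℕ) : ℤ)) * ((i : ℤ) - 1) +
        (1 - (i : ℤ)) * ∑ j ∈ range 0, deg j) +
        ((((2 : ℕ) : ℤ) - 1 - ((1 : ℕ) : ℤ)) * ((j : ℤ) - 1) +
        (1 - (j : ℤ)) * ∑ l ∈ range (i + 0), deg l)) •
      𝒜.mul (hG.desuspend τ i fun l => a (0 + l)) (hG.desuspend τ j fun l => a (i + 0 + l)) = _
    simp only [zero_add, add_zero]
    rw [hτ.desuspend_apply hG i ha, hτ.desuspend_apply hG j fun l => ha (i + l),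
      hτ _ _ (hdeg i a deg ha)]
    -- In a product, the signs of the two factors are collected in front.
    have hbil : ∀ (m n : ℤ) (x y : A), 𝒜.mul (m.negOnePow • x) (n.negOnePow • y) =
        (m + n).negOnePow • 𝒜.mul x y := by
      intro m n x y
      rw [Int.negOnePow_add, mul_smul, Units.smul_def, Units.smul_def, Units.smul_def,
        Units.smul_def, map_zsmul, map_zsmul, LinearMap.smul_apply, smul_comm]
    have hbil' := hbil (∑ l ∈ range i, deg l + 1 - i) 0 (G (word i a))
      (G (word j fun l => a (i + l)))
    rw [Int.negOnePow_zero, one_smul, add_zero] at hbil'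
    rw [hbil, hbil', smul_smul, smul_smul, ← Int.negOnePow_add, ← Int.negOnePow_add]
    congr 1
    rw [Int.negOnePow_eq_iff]
    have e1 : ∑ l ∈ range (i + j), (((i + j : ℕ) : ℤ) - 1 - l) * deg l =
        ∑ l ∈ range i, ((i : ℤ) - 1 - l) * deg l + j * ∑ l ∈ range i, deg l +
          ∑ l ∈ range j, ((j : ℤ) - 1 - l) * deg (i + l) := by
      rw [Finset.sum_range_add, Finset.mul_sum, ← Finset.sum_add_distrib]
      congr 1
      · refine Finset.sum_congr rfl fun l _ => ?_
        push_cast; ring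
      · refine Finset.sum_congr rfl fun l _ => ?_
        push_cast; ring
    rw [e1]
    simp only [range_zero, sum_empty]
    push_cast
    exact ⟨i - 1 - j * ∑ l ∈ range i, deg l, by ring⟩
  · have : 𝒜.ops (i :: j :: l :: w).length = 0 := 𝒜.ops_of_three_le (by simp)
    change _ • 𝒜.ops (i :: j :: l :: w).length _ = _ • (0 : A)
    rw [this, zero_apply, smul_zero, smul_zero]

/-! ### Degrees and filtrations of the transferred operations -/

namespace TransferData

variable {k : Type u} {A : Type v} [Field k] [AddCommGroup A] [Module k A]

/-- The transfer data respect a family of subspaces `S p n`, where `n` is the degree and `p` the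
filtration index. -/
structure Respects (T : TransferData k A) (S : ℤ → ℤ → Submodule k A) : Prop where
  d_mem : ∀ p n, ∀ x ∈ S p n, T.d x ∈ S p (n + 1)
  H_mem : ∀ p n, ∀ x ∈ S p n, T.H x ∈ S p (n - 1)
  mul_mem : ∀ p n p' n', ∀ x ∈ S p n, ∀ y ∈ S p' n', T.mul x y ∈ S (p + p') (n + n')
  τ_mem : ∀ p n, ∀ x ∈ S p n, T.τ x ∈ S p n

namespace Respects

variable {T : TransferData k A} {S : ℤ → ℤ → Submodule k A}
  {a : ℕ → A} {p deg : ℕ → ℤ}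

theorem letter_mem (ha : ∀ i, a i ∈ S (p i) (deg i)) (n : ℕ) :
    letter (word n a) ∈ S (∑ i ∈ range n, p i) (∑ i ∈ range n, deg i + 1 - n) := by
  match n with
  | 0 => exact Submodule.zero_mem _
  | 1 => simpa [word, letter] using ha 0
  | n + 2 => rw [word_succ, word_succ]; exact Submodule.zero_mem _

theorem cup_mem (hT : T.Respects S) (n : ℕ)
    (hf : ∀ m < n, ∀ (a : ℕ → A) (p deg : ℕ → ℤ), (∀ i, a i ∈ S (p i) (deg i)) →
      T.f (word m a) ∈ S (∑ i ∈ range m, p i) (∑ i ∈ range m, deg i + 1 - m))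
    (ha : ∀ i, a i ∈ S (p i) (deg i)) :
    T.cup T.f (word n a) ∈ S (∑ i ∈ range n, p i) (∑ i ∈ range n, deg i + 2 - n) := by
  rw [cup, splitSum_word]
  refine Submodule.sum_mem _ fun x hx => ?_
  obtain ⟨i, j⟩ := x
  rw [HasAntidiagonal.mem_antidiagonal] at hx
  have h0 : ∀ a : ℕ → A, T.f (word 0 a) = 0 := fun _ => T.f_nil
  dsimp only at hx ⊢
  rcases Nat.eq_zero_or_pos i with rfl | hi
  · rw [h0]; simp
  rcases Nat.eq_zero_or_pos j with rfl | hj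
  · rw [h0]; simp
  have h1 := hT.τ_mem _ _ _ (hf i (by omega) a p deg ha)
  have h2 := hf j (by omega) (fun l => a (i + l)) (fun l => p (i + l)) (fun l => deg (i + l))
    fun l => ha _
  convert hT.mul_mem _ _ _ _ _ h1 _ h2 using 2
  · rw [← hx, Finset.sum_range_add]
  · rw [← hx, Finset.sum_range_add]
    push_cast
    ring

theorem f_mem (hT : T.Respects S) (ha : ∀ i, a i ∈ S (p i) (deg i)) (n : ℕ) :
    T.f (word n a) ∈ S (∑ i ∈ range n, p i) (∑ i ∈ range n, deg i + 1 - n) := by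
  induction n using Nat.strong_induction_on generalizing a p deg with
  | _ n ih =>
    have h := hT.H_mem _ _ _ (hT.cup_mem n (fun m hm a p deg ha => ih m hm ha) ha)
    rw [show ∑ i ∈ range n, deg i + 2 - (n : ℤ) - 1 = ∑ i ∈ range n, deg i + 1 - n by ring] at h
    rw [f_eq]
    exact Submodule.sub_mem _ (letter_mem ha n) h

theorem proj_mem (hT : T.Respects S) {p n : ℤ} {x : A} (hx : x ∈ S p n) : T.proj x ∈ S p n := by
  have h1 := hT.d_mem _ _ _ (hT.H_mem _ _ _ hx)
  have h2 := hT.H_mem _ _ _ (hT.d_mem _ _ _ hx)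
  rw [sub_add_cancel] at h1
  rw [add_sub_cancel_right] at h2
  exact Submodule.sub_mem _ (Submodule.sub_mem _ hx h1) h2

theorem b_mem (hT : T.Respects S) (ha : ∀ i, a i ∈ S (p i) (deg i)) (n : ℕ) :
    T.b (word n a) ∈ S (∑ i ∈ range n, p i) (∑ i ∈ range n, deg i + 2 - n) := by
  have h := hT.d_mem _ _ _ (letter_mem ha n)
  rw [show ∑ i ∈ range n, deg i + 1 - (n : ℤ) + 1 = ∑ i ∈ range n, deg i + 2 - n by ring] at h
  exact Submodule.add_mem _ h
    (hT.proj_mem (hT.cup_mem n (fun m _ a p deg ha => hT.f_mem ha m) ha))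

/-- If `G` has degree `c` as a map from words, with the suspended grading, to `A`, then the `s`-ary
component of its desuspension has degree `c - s`; filtrations are likewise preserved. -/
theorem desuspend_mem (hT : T.Respects S) {G : List A → A} (hG : IsWordLinear k G) (c : ℤ)
    (hGS : ∀ {a : ℕ → A} {p deg : ℕ → ℤ}, (∀ i, a i ∈ S (p i) (deg i)) → ∀ n : ℕ,
      G (word n a) ∈ S (∑ i ∈ range n, p i) (∑ i ∈ range n, deg i + c - n))
    (s : ℕ) (x : Fin s → A) (p n : Fin s → ℤ) (hx : ∀ i, x i ∈ S (p i) (n i)) :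
    hG.desuspend T.τ s x ∈ S (∑ i, p i) (∑ i, n i + c - s) := by
  have hpow : ∀ (j : ℕ) (p n : ℤ), ∀ y ∈ S p n, (T.τ ^ j) y ∈ S p n := by
    intro j p n y hy
    induction j with
    | zero => exact hy
    | succ j ih => rw [pow_succ', Module.End.mul_apply]; exact hT.τ_mem _ _ _ ih
  let a : ℕ → A := fun i => if h : i < s then (T.τ ^ (s - 1 - i)) (x ⟨i, h⟩) else 0
  let p' : ℕ → ℤ := fun i => if h : i < s then p ⟨i, h⟩ else 0
  let n' : ℕ → ℤ := fun i => if h : i < s then n ⟨i, h⟩ else 0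
  have h := hGS (a := a) (p := p') (deg := n') (fun i => by
    by_cases h : i < s
    · simpa only [a, p', n', dif_pos h] using hpow _ _ _ _ (hx ⟨i, h⟩)
    · simp only [a, dif_neg h]; exact Submodule.zero_mem _) s
  rw [Finset.sum_range, Finset.sum_range] at h
  rw [IsWordLinear.desuspend_apply]
  simpa [a, p', n', word] using h

end Respects

/-- The components of `b` of arity at least two take values in the image of `1 - d H - H d`. -/
theorem b_mem_of_letter_mem (T : TransferData k A) {M : Submodule k A}
    (hd : ∀ x ∈ M, T.d x ∈ M) (hproj : ∀ x, T.proj x ∈ M) {w : List A} (hw : letter w ∈ M) :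
    T.b w ∈ M :=
  Submodule.add_mem _ (hd _ hw) (hproj _)

end TransferData

/-! ### The minimal model -/

namespace FilteredDGAlgebra

variable {k : Type u} {A : Type v} [Field k] [AddCommGroup A] [Module k A]
  (𝒜 : FilteredDGAlgebra k A) (h : 𝒜.toFilteredComplex.Contraction) {τ : A →ₗ[k] A}
  (hτ : 𝒜.IsSign τ)

/-- The transfer data of a filtered contraction. -/
def transferData : TransferData k A where
  d := 𝒜.d
  mul := 𝒜.mul
  τ := τ
  H := h.H
  d_d := 𝒜.d_d
  mul_assoc := 𝒜.mul_assoc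
  d_mul x y := 𝒜.ext_homogeneous (f := 𝒜.d ∘ₗ 𝒜.mul.flip y)
    (g := 𝒜.mul.flip y ∘ₗ 𝒜.d + 𝒜.mul.flip (𝒜.d y) ∘ₗ τ) (fun n x hx => by
      simp only [LinearMap.add_apply, LinearMap.comp_apply, LinearMap.flip_apply,
        𝒜.leibniz n x hx, hτ n x hx]
      rw [Units.smul_def, Units.smul_def, map_zsmul, LinearMap.smul_apply]) x
  τ_τ x := 𝒜.ext_homogeneous (f := τ ∘ₗ τ) (g := LinearMap.id) (fun n x hx => by
      rw [LinearMap.comp_apply, hτ n _ (hτ.mem le_rfl hx), hτ n x hx, smul_smul,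
        Int.units_mul_self, one_smul, LinearMap.id_apply]) x
  τ_d x := 𝒜.ext_homogeneous (f := τ ∘ₗ 𝒜.d) (g := -(𝒜.d ∘ₗ τ)) (fun n x hx => by
      rw [LinearMap.neg_apply, LinearMap.comp_apply, LinearMap.comp_apply,
        hτ _ _ (𝒜.d_mem n x hx), hτ n x hx, Int.negOnePow_succ, Units.neg_smul, Units.smul_def,
        Units.smul_def, map_zsmul]) x
  τ_H x := 𝒜.ext_homogeneous (f := τ ∘ₗ h.H) (g := -(h.H ∘ₗ τ)) (fun n x hx => by
      rw [LinearMap.neg_apply, LinearMap.comp_apply, LinearMap.comp_apply,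
        hτ _ _ (h.H_gr n x hx), hτ n x hx, Int.negOnePow_sub, Int.negOnePow_one, mul_neg_one,
        Units.neg_smul, Units.smul_def, Units.smul_def, map_zsmul]) x
  τ_mul x y := by
    refine 𝒜.ext_homogeneous (f := τ ∘ₗ 𝒜.mul.flip y) (g := 𝒜.mul.flip (τ y) ∘ₗ τ)
      (fun n x hx => ?_) x
    refine 𝒜.ext_homogeneous (f := τ ∘ₗ 𝒜.mul x) (g := 𝒜.mul (τ x) ∘ₗ τ) (fun m y hy => ?_) y
    rw [LinearMap.comp_apply, LinearMap.comp_apply, hτ _ _ (𝒜.mul_mem n m x hx y hy), hτ n x hx,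
      hτ m y hy, Int.negOnePow_add, mul_smul]
    simp only [Units.smul_def, map_zsmul, LinearMap.smul_apply]
    rw [smul_comm]

theorem transferData_respects_F : (𝒜.transferData h hτ).Respects 𝒜.F where
  d_mem := 𝒜.d_F
  H_mem := h.H_F
  mul_mem := 𝒜.mul_F
  τ_mem p n _ hx := hτ.mem (𝒜.F_le p n) hx

theorem transferData_respects_gr : (𝒜.transferData h hτ).Respects fun _ n => 𝒜.gr n where
  d_mem _ := 𝒜.d_mem
  H_mem _ := h.H_gr
  mul_mem _ n _ n' := 𝒜.mul_mem n n'
  τ_mem _ n _ hx := hτ.mem (n := n) le_rfl hx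

/-- The transferred operations on the whole dg-algebra. -/
def transferOps (s : ℕ) : MultilinearMap k (fun _ : Fin s => A) A :=
  (𝒜.transferData h hτ).isWordLinear_b.desuspend τ s

/-- The components of the transferred morphism on the whole dg-algebra. -/
def transferMaps (s : ℕ) : MultilinearMap k (fun _ : Fin s => A) A :=
  (𝒜.transferData h hτ).isWordLinear_f.desuspend τ s

theorem transferOps_F (s : ℕ) (x : Fin s → A) (p n : Fin s → ℤ) (hx : ∀ i, x i ∈ 𝒜.F (p i) (n i)) :
    𝒜.transferOps h hτ s x ∈ 𝒜.F (∑ i, p i) (∑ i, n i + 2 - s) :=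
  (𝒜.transferData_respects_F h hτ).desuspend_mem _ 2
    (fun ha => (𝒜.transferData_respects_F h hτ).b_mem ha) s x p n hx

theorem transferOps_gr (s : ℕ) (x : Fin s → A) (n : Fin s → ℤ) (hx : ∀ i, x i ∈ 𝒜.gr (n i)) :
    𝒜.transferOps h hτ s x ∈ 𝒜.gr (∑ i, n i + 2 - s) :=
  (𝒜.transferData_respects_gr h hτ).desuspend_mem _ 2
    (fun {_ p _} ha => (𝒜.transferData_respects_gr h hτ).b_mem (p := p) ha) s x 0 n hx

theorem transferMaps_F (s : ℕ) (x : Fin s → A) (p n : Fin s → ℤ)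
    (hx : ∀ i, x i ∈ 𝒜.F (p i) (n i)) :
    𝒜.transferMaps h hτ s x ∈ 𝒜.F (∑ i, p i) (∑ i, n i + 1 - s) :=
  (𝒜.transferData_respects_F h hτ).desuspend_mem _ 1
    (fun ha => (𝒜.transferData_respects_F h hτ).f_mem ha) s x p n hx

theorem transferMaps_gr (s : ℕ) (x : Fin s → A) (n : Fin s → ℤ) (hx : ∀ i, x i ∈ 𝒜.gr (n i)) :
    𝒜.transferMaps h hτ s x ∈ 𝒜.gr (∑ i, n i + 1 - s) :=
  (𝒜.transferData_respects_gr h hτ).desuspend_mem _ 1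
    (fun {_ p _} ha => (𝒜.transferData_respects_gr h hτ).f_mem (p := p) ha) s x 0 n hx

theorem transferOps_zero : 𝒜.transferOps h hτ 0 = 0 :=
  MultilinearMap.ext fun _ => (𝒜.transferData h hτ).b_nil

theorem transferMaps_zero : 𝒜.transferMaps h hτ 0 = 0 :=
  MultilinearMap.ext fun _ => (𝒜.transferData h hτ).f_nil

theorem transferOps_one (x : A) : 𝒜.transferOps h hτ 1 (fun _ => x) = 𝒜.d x :=
  (𝒜.transferData h hτ).b_singleton x

theorem transferMaps_one (x : A) : 𝒜.transferMaps h hτ 1 (fun _ => x) = x :=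
  (𝒜.transferData h hτ).f_singleton x

theorem transferOps_mem_minimalPart (s : ℕ) (x : Fin s → A) (hx : ∀ i, x i ∈ h.minimalPart) :
    𝒜.transferOps h hτ s x ∈ h.minimalPart := by
  refine (𝒜.transferData h hτ).b_mem_of_letter_mem (fun _ => h.d_mem_minimalPart) h.proj_mem ?_
  match s with
  | 0 => exact Submodule.zero_mem _
  | 1 => exact hx 0
  | s + 2 => rw [List.ofFn_succ, List.ofFn_succ]; exact Submodule.zero_mem _

theorem innerSum_transferOps {a : ℕ → A} {deg : ℕ → ℤ} (ha : ∀ i, a i ∈ 𝒜.gr (deg i)) (n : ℕ) :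
    innerSum (𝒜.transferOps h hτ) (𝒜.transferOps h hτ) n a deg = 0 := by
  refine (hτ.innerSum_desuspend _ _ (𝒜.transferOps_gr h hτ) ha n).trans ?_
  have := (𝒜.transferData h hτ).insertSum_b (word n a)
  exact (congrArg _ this).trans (smul_zero _)

theorem innerSum_transferMaps {a : ℕ → A} {deg : ℕ → ℤ} (ha : ∀ i, a i ∈ 𝒜.gr (deg i)) (n : ℕ) :
    innerSum (𝒜.transferOps h hτ) (𝒜.transferMaps h hτ) n a deg =
      outerSum 𝒜.ops (𝒜.transferMaps h hτ) n a deg := by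
  refine (hτ.innerSum_desuspend _ _ (𝒜.transferOps_gr h hτ) ha n).trans ?_
  refine Eq.trans ?_ (𝒜.outerSum_desuspend hτ _ (𝒜.transferData h hτ).f_nil
    (fun s a deg ha => (𝒜.transferData_respects_gr h hτ).f_mem (p := 0) ha s) ha n).symm
  congr 1
  have := (𝒜.transferData h hτ).f_isMorphism (word n a)
  rw [sub_add_eq_add_sub] at this
  exact (sub_eq_zero.mp this).symm

/-- The `A∞`-relations on a subspace closed under the operations are restricted from the whole
space. -/
theorem coe_innerSum {X : Type w} [AddCommGroup X] [Module k X] {M : Submodule k A}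
    (m : (s : ℕ) → MultilinearMap k (fun _ : Fin s => M) M)
    (m' : (s : ℕ) → MultilinearMap k (fun _ : Fin s => A) A)
    (hm : ∀ s x, (m s x : A) = m' s fun i => x i)
    (f : (s : ℕ) → MultilinearMap k (fun _ : Fin s => A) X)
    (n : ℕ) (a : ℕ → M) (deg : ℕ → ℤ) :
    innerSum m (fun s => (f s).compLinearMap fun _ => M.subtype) n a deg =
      innerSum m' f n (fun i => a i) deg := by
  refine Finset.sum_congr rfl fun x _ => Finset.sum_congr rfl fun y _ => ?_
  simp only [innerTerm, MultilinearMap.compLinearMap_apply]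
  congr 2
  funext i
  rw [← hm]
  simp only [replaceBlock]
  split_ifs <;> rfl

/-- The `A∞`-structure on the minimal part. -/
def minimalAlgebra : FilteredAInftyAlgebra k h.minimalPart where
  toFilteredSpace := h.filteredSpace
  m s := ((𝒜.transferOps h hτ s).compLinearMap fun _ => h.minimalPart.subtype).codRestrict
    h.minimalPart fun x => 𝒜.transferOps_mem_minimalPart h hτ s _ fun i => (x i).2
  m_zero := MultilinearMap.ext fun x => Subtype.ext
    (DFunLike.congr_fun (𝒜.transferOps_zero h hτ) _)
  m_mem s x n hx := 𝒜.transferOps_gr h hτ s _ n hx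
  m_F s x p n hx := 𝒜.transferOps_F h hτ s _ p n hx
  stasheff n a deg ha := by
    set m : (s : ℕ) → MultilinearMap k (fun _ : Fin s => h.minimalPart) h.minimalPart := fun s =>
      ((𝒜.transferOps h hτ s).compLinearMap fun _ => h.minimalPart.subtype).codRestrict
        h.minimalPart fun x => 𝒜.transferOps_mem_minimalPart h hτ s _ fun i => (x i).2
    apply Subtype.ext
    have h1 : ((innerSum m m n a deg : h.minimalPart) : A) =
        innerSum m (fun s => (𝒜.transferOps h hτ s).compLinearMap fun _ =>
          h.minimalPart.subtype) n a deg := by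
      simp only [innerSum, innerTerm, AddSubmonoidClass.coe_finsetSum, Units.smul_def,
        Submodule.coe_smul_of_tower]
      rfl
    rw [h1, coe_innerSum m (𝒜.transferOps h hτ) (fun _ _ => rfl)]
    exact 𝒜.innerSum_transferOps h hτ (a := fun i => (a i : A)) ha n

theorem minimalAlgebra_d (x : h.minimalPart) :
    ((𝒜.minimalAlgebra h hτ).toFilteredComplex.d x : A) = 𝒜.d x :=
  𝒜.transferOps_one h hτ x

/-- The transferred morphism from the minimal part. -/
def minimalHom : FilteredAInftyHom (𝒜.minimalAlgebra h hτ) 𝒜.toFilteredAInfty where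
  f s := (𝒜.transferMaps h hτ s).compLinearMap fun _ => h.minimalPart.subtype
  f_zero := MultilinearMap.ext fun x =>
    DFunLike.congr_fun (𝒜.transferMaps_zero h hτ) fun i => (x i : A)
  f_mem s x n hx := 𝒜.transferMaps_gr h hτ s _ n hx
  f_F s x p n hx := 𝒜.transferMaps_F h hτ s _ p n hx
  rel n a deg ha := by
    rw [coe_innerSum _ (𝒜.transferOps h hτ) (fun _ _ => rfl)]
    exact 𝒜.innerSum_transferMaps h hτ (a := fun i => (a i : A)) ha n

theorem minimalHom_linearPart (x : h.minimalPart) : (𝒜.minimalHom h hτ).linearPart.f x = x :=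
  𝒜.transferMaps_one h hτ x

theorem minimalHom_isFilteredQuasiIso : (𝒜.minimalHom h hτ).IsFilteredQuasiIso := by
  intro p n
  constructor
  · rw [injective_iff_map_eq_zero]
    intro x hx
    obtain ⟨⟨x, hx1, hx2⟩, rfl⟩ := Submodule.Quotient.mk_surjective _ x
    have hx : (𝒜.minimalHom h hτ).linearPart.f x ∈
        𝒜.toFilteredAInfty.toFilteredComplex.coboundaries p n :=
      (Submodule.Quotient.mk_eq_zero
        ((𝒜.toFilteredAInfty.toFilteredComplex.coboundaries p n).submoduleOf _)).mp hx
    rw [minimalHom_linearPart] at hx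
    obtain ⟨y, hy, hyx⟩ := hx
    have hyx : 𝒜.d y = x := hyx
    refine (Submodule.Quotient.mk_eq_zero _).mpr
      ⟨⟨h.proj y, h.proj_mem y⟩, h.proj_F _ _ _ hy, Subtype.ext ?_⟩
    rw [minimalAlgebra_d]
    change 𝒜.d (h.proj y) = x
    rw [← h.proj_d, hyx, h.proj_eq_self x.2]
  · intro x
    obtain ⟨⟨x, hx1, hx2⟩, rfl⟩ := Submodule.Quotient.mk_surjective _ x
    have hx1 : x ∈ 𝒜.F p n := hx1
    have hx2 : 𝒜.d x = 0 := hx2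
    refine ⟨Submodule.Quotient.mk ⟨⟨h.proj x, h.proj_mem x⟩, h.proj_F _ _ _ hx1, ?_⟩, ?_⟩
    · refine LinearMap.mem_ker.mpr (Subtype.ext ?_)
      rw [minimalAlgebra_d]
      change 𝒜.d (h.proj x) = 0
      rw [← h.proj_d, hx2, map_zero]
    · refine (Submodule.Quotient.eq _).mpr ⟨-h.H x, Submodule.neg_mem _ (h.H_F _ _ _ hx1), ?_⟩
      change 𝒜.d (-h.H x) = (𝒜.minimalHom h hτ).linearPart.f ⟨h.proj x, h.proj_mem x⟩ - x
      rw [minimalHom_linearPart, map_neg]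
      change -𝒜.d (h.H x) = x - 𝒜.d (h.H x) - h.H (𝒜.d x) - x
      rw [hx2, map_zero]
      abel

/-- Complements of the filtration steps of the minimal part give a bigrading. -/
def minimalBigrading {G : ℤ → ℤ → Submodule k h.minimalPart}
    (hsup : ∀ p n, h.filteredSpace.F (p + 1) n ⊔ G p n = h.filteredSpace.F p n)
    (hdis : ∀ p n, Disjoint (h.filteredSpace.F (p + 1) n) (G p n)) :
    (𝒜.minimalAlgebra h hτ).MinimalBigrading where
  bigr p q := G p (p + q)
  bigr_isInternal := by
    have := FilteredSpace.isInternal_of_complements hsup hdis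
    rw [DirectSum.isInternal_submodule_iff_iSupIndep_and_iSup_eq_top] at this ⊢
    let e : ℤ × ℤ ≃ ℤ × ℤ :=
      { toFun := fun x => (x.1, x.1 + x.2)
        invFun := fun x => (x.1, x.2 - x.1)
        left_inv := fun x => by simp
        right_inv := fun x => by simp }
    exact ⟨this.1.comp e.injective, (e.iSup_comp (g := fun x => G x.1 x.2)).trans this.2⟩
  bigr_le p q := (le_sup_right.trans (hsup _ _).le).trans (h.filteredSpace.F_le _ _)
  F_eq p n := by
    simp only [add_sub_cancel]
    exact FilteredSpace.F_eq_iSup hsup p n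
  d_F_succ p n x hx := by
    change ((𝒜.minimalAlgebra h hτ).toFilteredComplex.d x : A) ∈ 𝒜.F (p + 1) (n + 1)
    rw [minimalAlgebra_d]
    exact h.d_F_succ p n x hx x.2

end FilteredDGAlgebra

/-- A complement of `Fᵖ⁺¹` in `Fᵖ` on the minimal part is isomorphic to the first page. -/
theorem FilteredComplex.Contraction.nonempty_equiv_E1 {k : Type u} {A : Type v} [Field k]
    [AddCommGroup A] [Module k A] {C : FilteredComplex k A} (h : C.Contraction) (p q : ℤ)
    {G : Submodule k h.minimalPart}
    (hsup : h.filteredSpace.F (p + 1) (p + q) ⊔ G = h.filteredSpace.F p (p + q))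
    (hdis : Disjoint (h.filteredSpace.F (p + 1) (p + q)) G) : Nonempty (G ≃ₗ[k] C.E1 p q) := by
  have hGF : ∀ x ∈ G, (x : A) ∈ C.F p (p + q) := fun x hx =>
    (le_sup_right.trans hsup.le : G ≤ h.filteredSpace.F p (p + q)) hx
  let f : G →ₗ[k] C.E1 p q := Submodule.mkQ _ ∘ₗ
    (h.minimalPart.subtype ∘ₗ G.subtype).codRestrict (C.Z1 p q) fun x =>
      ⟨hGF _ x.2, h.d_F_succ p _ _ (hGF _ x.2) x.1.2⟩
  refine ⟨LinearEquiv.ofBijective f ⟨?_, ?_⟩⟩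
  · rw [injective_iff_map_eq_zero]
    rintro ⟨x, hx⟩ h0
    have h0 : (x : A) ∈ C.B1 p q :=
      (Submodule.Quotient.mk_eq_zero ((C.B1 p q).submoduleOf (C.Z1 p q))).mp h0
    obtain ⟨y, hy, _, ⟨z, hz, rfl⟩, hyz⟩ := Submodule.mem_sup.mp h0
    -- Project to the minimal part, where coboundaries raise the filtration.
    have hxy : (x : A) = h.proj y + C.d (h.proj z) := by
      rw [← h.proj_d, ← map_add, hyz, h.proj_eq_self x.2]
    have hz' := h.d_F_succ p _ _ (h.proj_F _ _ _ hz) (h.proj_mem z)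
    rw [sub_add_cancel] at hz'
    have hxF : x ∈ h.filteredSpace.F (p + 1) (p + q) := by
      change (x : A) ∈ C.F (p + 1) (p + q)
      rw [hxy]
      exact Submodule.add_mem _ (h.proj_F _ _ _ hy) hz'
    exact Subtype.ext (Submodule.disjoint_def.mp hdis x hxF hx)
  · intro x
    obtain ⟨⟨x, hx1, hx2⟩, rfl⟩ := Submodule.Quotient.mk_surjective _ x
    have hx2 : C.d x ∈ C.F (p + 1) (p + q + 1) := hx2
    have hP : (⟨h.proj x, h.proj_mem x⟩ : h.minimalPart) ∈ h.filteredSpace.F p (p + q) :=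
      h.proj_F _ _ _ hx1
    rw [← hsup] at hP
    obtain ⟨y, hy, g, hg, hyg⟩ := Submodule.mem_sup.mp hP
    refine ⟨⟨g, hg⟩, (Submodule.Quotient.eq _).mpr ?_⟩
    change (g : A) - x ∈ C.B1 p q
    have hyg' : (y : A) + g = h.proj x := congrArg Subtype.val hyg
    have hgx : (g : A) - x = -(y + h.H (C.d x)) + C.d (-h.H x) := by
      rw [eq_sub_of_add_eq' hyg', h.proj_apply, map_neg]; abel
    rw [hgx]
    have hHd := h.H_F _ _ _ hx2
    rw [add_sub_cancel_right] at hHd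
    exact Submodule.add_mem_sup (Submodule.neg_mem _ (Submodule.add_mem _ hy hHd))
      ⟨_, Submodule.neg_mem _ (h.H_F _ _ _ hx1), rfl⟩

theorem theorem3p9 {k : Type u} {A : Type v} [Field k] [AddCommGroup A] [Module k A]
    (𝒜 : FilteredDGAlgebra k A) :
    ∃ M : 𝒜.MinimalModel, ∀ p q : ℤ,
      Nonempty (M.bigrading.bigr p q ≃ₗ[k] 𝒜.toFilteredComplex.E1 p q) := by
  classical
  obtain ⟨h⟩ := 𝒜.toFilteredComplex.exists_contraction
  obtain ⟨τ, hτ⟩ := exists_linearMap_of_isInternal 𝒜.isInternal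
    fun n => n.negOnePow • (LinearMap.id : A →ₗ[k] A)
  have hτ : 𝒜.IsSign τ := hτ
  have hG : ∀ p n, ∃ G, h.filteredSpace.F (p + 1) n ⊔ G = h.filteredSpace.F p n ∧
      Disjoint (h.filteredSpace.F (p + 1) n) G := fun p n => by
    obtain ⟨G, -, hG⟩ := exists_relative_complement (b := ⊥) (h.filteredSpace.F_anti p n)
      bot_le disjoint_bot_right
    exact ⟨G, hG⟩
  choose G hsup hdis using hG
  exact ⟨{  carrier := h.minimalPart
            alg := 𝒜.minimalAlgebra h hτ
            bigrading := 𝒜.minimalBigrading h hτ hsup hdis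
            hom := 𝒜.minimalHom h hτ
            isFilteredQuasiIso := 𝒜.minimalHom_isFilteredQuasiIso h hτ },
    fun p q => h.nonempty_equiv_E1 p q (hsup p _) (hdis p _)⟩
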